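/- **Systems.** Let $N,n,m,p\ge 0$ be integers. For $i=1,\dots,N$ consider the Euler–Lagrange systems $$M_i(q_i)\ddot q_i+C_i(q_i,\dot q_i)\dot q_i+G_i(q_i)=\tau_i,\qquad q_i\in\mathbb R^n,$$ where $M_i$ is $C^1$ with symmetric positive definite values, $C_i$ and $G_i$ are locally Lipschitz, $\dot M_i(q)-2C_i(q,\dot q)$ is skew symmetric for all $q,\dot q\in\mathbb R^n$ (with $\dot M_i(q)$ the derivative of $M_i$ at $q$ in the direction $\dot q$), and there are a known locally Lipschitz matrix function $Y_i(q,\dot q,x,y)\in\mathbb R^{n\times p}$ and an unknown constant vector $\Theta_i\in\mathbb R^p$ with $M_i(q)x+C_i(q,\dot q)y+G_i(q)=Y_i(q,\dot q,x,y)\Theta_i$ for all $q,\dot q,x,y\in\mathbb R^n$. The leader is $\dot v=Sv$, $q_0=Cv$ with $v\in\mathbb R^m$ and $(C,S)$ observable. **Network.** Let $\bar{\mathcal G}_1,\dots,\bar{\mathcal G}_{n_0}$ be digraphs on the nodes $0,1,\dots,N$ (node $0$ is the leader), with weighted adjacency matrices: nonnegative, zero diagonal, and with a positive $(i,j)$ entry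 if and only if $(j,i)$ is an edge. Let $\sigma:[0,\infty)\to\{1,\dots,n_0\}$ be constant on each interval $[t_k,t_{k+1})$, where $t_0=0$ and $t_{k+1}-t_k\ge\tau_0>0$, and let $a_{ij}(t)$ be the weights of $\bar{\mathcal G}_{\sigma(t)}$. **Assumptions.** 1. $\dot q_0=CSv$ is bounded on $[0,\infty)$ for every $v(0)\in\mathbb R^m$. 2. There are positive constants $k_{\underline m},k_{\overline m},k_c,k_g$ such that, for all $i$ and all $q,\dot q$, $k_{\underline m}I\le M_i(q)\le k_{\overline m}I$, $\|C_i(q,\dot q)\|\le k_c\|\dot q\|$ and $\|G_i(q)\|\le k_g$. Moreover, for each $i$ and each $R$, $Y_i(q,\dot q,x,y)$ is bounded on the set of all $(q,\dot q,x,y)$ with $\|\dot q\|,\|x\|,\|y\|\le R$ (and $q$ arbitrary). 3. (Joint connectivity.) There are $\epsilon>0$ and a subsequence $\{i_k\}$ of $\{0,1,2,\dots\}$ with $t_{i_{k+1}}-t_{i_k}<\epsilon$ such that for every $k$ each node $1,\dots,N$ is reachable from node $0$ in the union digraph $\bigcup_{j=i_k}^{i_{k+1}-1}\bar{\mathcal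 G}_{\sigma(t_j)}$. **Control law.** Let $\mu_1,\mu_2,\alpha>0$ and let $K_i\in\mathbb R^{n\times n}$, $\Lambda_i\in\mathbb R^{p\times p}$ be symmetric positive definite. Put $S_0=S$, $\eta_0=v$, $\xi_i=C\eta_i$, $\dot q_{ri}=CS_i\eta_i-\alpha(q_i-\xi_i)$, $\ddot q_{ri}=C(\dot S_i\eta_i+S_i\dot\eta_i)-\alpha(\dot q_i-\dot\xi_i)$, $s_i=\dot q_i-\dot q_{ri}$, $Y_i=Y_i(q_i,\dot q_i,\ddot q_{ri},\dot q_{ri})$, and $$\tau_i=-K_is_i+Y_i\hat\Theta_i,\qquad \dot{\hat\Theta}_i=-\Lambda_i^{-1}Y_i^{T}s_i,$$ $$\dot S_i=\mu_1\sum_{j=0}^Na_{ij}(t)(S_j-S_i),\qquad \dot\eta_i=S_i\eta_i+\mu_2\sum_{j=0}^Na_{ij}(t)(\eta_j-\eta_i),\qquad i=1,\dots,N,$$ where the $\dot S_i,\dot\eta_i$ in $\ddot q_{ri}$ stand for the right-hand sides in the last line. **Theorem 1.** This law is distributed: at each time $\tau_i$ and the rates of $\hat\Theta_i,S_i,\eta_i$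 depend only on $q_i,\dot q_i,\hat\Theta_i,S_i,\eta_i$ and on the differences $S_j-S_i$, $\eta_j-\eta_i$ over the neighbors $j$ of $i$ in $\bar{\mathcal G}_{\sigma(t)}$. It solves the leader-following consensus problem: for all initial conditions $v(0)$, $q_i(0)$, $\dot q_i(0)$, $\hat\Theta_i(0)$, $S_i(0)$, $\eta_i(0)$ the closed-loop system has a solution on $[0,\infty)$, and along every such solution, for $i=1,\dots,N$, $$\lim_{t\to\infty}(q_i(t)-q_0(t))=0,\qquad \lim_{t\to\infty}(\dot q_i(t)-\dot q_0(t))=0.$$ -/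

import Mathlib

open Set Filter Topology

/-- The Euclidean space `ℝᵏ`. The definitions below are made for arbitrary Euclidean spaces `E`
(positions), `F` (leader states) and `Q` (parameters), and are used for `Vec n`, `Vec m` and
`Vec p`. Matrices are the linear maps `A : F →L[ℝ] E`, so that their norm is the one induced by the
Euclidean norms and their transpose is `ContinuousLinearMap.adjoint A`. -/
abbrev Vec (k : ℕ) := EuclideanSpace ℝ (Fin k)

/-- Symmetric positive definite matrices. -/
def IsPosDef {E : Type} [NormedAddCommGroup E] [InnerProductSpace ℝ E] [CompleteSpace E]
    (A : E →L[ℝ] E) : Prop :=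
  IsSelfAdjoint A ∧ ∀ x : E, x ≠ 0 → 0 < inner ℝ x (A x)

/-- An Euler–Lagrange system `M(q) q'' + Cor(q, q') q' + G(q) = τ` on a Euclidean space, with
inertia matrix `M`, Coriolis and centripetal matrix `Cor`, gravity vector `G`, regression matrix
`Y` and vector `Θ` of (uncertain) parameters. -/
structure ELSystem (E : Type) [NormedAddCommGroup E] [InnerProductSpace ℝ E] [CompleteSpace E]
    (Q : Type) [NormedAddCommGroup Q] [InnerProductSpace ℝ Q] [CompleteSpace Q] where
  M : E → (E →L[ℝ] E)
  Cor : E → E → (E →L[ℝ] E)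
  G : E → E
  Y : E → E → E → E → (Q →L[ℝ] E)
  Θ : Q
  contDiff_M : ContDiff ℝ 1 M
  locallyLipschitz_Cor : LocallyLipschitz fun z : E × E => Cor z.1 z.2
  locallyLipschitz_G : LocallyLipschitz G
  locallyLipschitz_Y :
    LocallyLipschitz fun z : E × E × E × E => Y z.1 z.2.1 z.2.2.1 z.2.2.2
  isPosDef_M : ∀ q, IsPosDef (M q)
  /-- `Ṁ(q) - 2 Cor(q, q̇)` is skew symmetric, where `Ṁ(q)` is the derivative of `M` at `q` in the
  direction of the velocity `w = q̇`. -/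
  skew : ∀ q w, ContinuousLinearMap.adjoint (fderiv ℝ M q w - (2 : ℝ) • Cor q w) =
    -(fderiv ℝ M q w - (2 : ℝ) • Cor q w)
  /-- Linear parametrization of the dynamics. -/
  regressor : ∀ q w x y, M q x + Cor q w y + G q = Y q w x y Θ

/-- Bounds on the inertia, Coriolis and gravity terms, uniform over the followers. -/
def UniformlyBounded {N : ℕ}
    {E : Type} [NormedAddCommGroup E] [InnerProductSpace ℝ E] [CompleteSpace E]
    {Q : Type} [NormedAddCommGroup Q] [InnerProductSpace ℝ Q] [CompleteSpace Q]
    (sys : Fin N → ELSystem E Q) : Prop :=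
  ∃ km kM kc kg : ℝ, 0 < km ∧ 0 < kM ∧ 0 < kc ∧ 0 < kg ∧ ∀ i,
    (∀ q x, km * ‖x‖ ^ 2 ≤ inner ℝ x ((sys i).M q x) ∧
      inner ℝ x ((sys i).M q x) ≤ kM * ‖x‖ ^ 2) ∧
    (∀ q w, ‖(sys i).Cor q w‖ ≤ kc * ‖w‖) ∧
    ∀ q, ‖(sys i).G q‖ ≤ kg

/-- The regression matrix `Y(q, w, x, y)` stays bounded, uniformly in the position `q`, as long as
`w`, `x` and `y` stay bounded. -/
def RegressorBounded
    {E : Type} [NormedAddCommGroup E] [InnerProductSpace ℝ E] [CompleteSpace E]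
    {Q : Type} [NormedAddCommGroup Q] [InnerProductSpace ℝ Q] [CompleteSpace Q]
    (s : ELSystem E Q) : Prop :=
  ∀ R : ℝ, ∃ B : ℝ, ∀ q w x y, ‖w‖ ≤ R → ‖x‖ ≤ R → ‖y‖ ≤ R → ‖s.Y q w x y‖ ≤ B

/-- The pair `(C, S)` is observable: the matrix with the blocks `C, CS, …, CS^{m-1}`, `m` being
the dimension of the leader's state, has trivial kernel. -/
def IsObservable {E F : Type} [NormedAddCommGroup E] [InnerProductSpace ℝ E]
    [NormedAddCommGroup F] [InnerProductSpace ℝ F] (C : F →L[ℝ] E) (S : F →L[ℝ] F) : Prop :=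
  ∀ x : F, (∀ k < Module.finrank ℝ F, C ((S ^ k) x) = 0) → x = 0

/-- `v' = S v` on `[0, ∞)`. -/
def IsLeaderTrajectory {F : Type} [NormedAddCommGroup F] [InnerProductSpace ℝ F]
    (S : F →L[ℝ] F) (v : ℝ → F) : Prop :=
  ∀ t, 0 ≤ t → HasDerivWithinAt v (S (v t)) (Ici 0) t

/-- The leader's velocity `q₀' = C v' = C S v` is bounded on `[0, ∞)`, along every trajectory of
the leader. -/
def LeaderVelocityBounded {E F : Type} [NormedAddCommGroup E] [InnerProductSpace ℝ E]
    [NormedAddCommGroup F] [InnerProductSpace ℝ F] (C : F →L[ℝ] E) (S : F →L[ℝ] F) : Prop :=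
  ∀ v : ℝ → F, IsLeaderTrajectory S v → ∃ B : ℝ, ∀ t, 0 ≤ t → ‖C (S (v t))‖ ≤ B

/-- Piecewise constant switching signals on `[0, ∞)` with a positive dwell time. -/
structure SwitchingSignal (P : Type) where
  σ : ℝ → P
  t : ℕ → ℝ
  τ₀ : ℝ
  t_zero : t 0 = 0
  τ₀_pos : 0 < τ₀
  dwell : ∀ i, τ₀ ≤ t (i + 1) - t i
  const : ∀ i, ∀ s ∈ Ico (t i) (t (i + 1)), σ s = σ (t i)

/-- `A` is a weighted adjacency matrix of the digraph `Γ`; `A i j` is the weight of the edge from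
`j` to `i`. -/
def IsWeightedAdjacency {V : Type} (A : Matrix V V ℝ) (Γ : Digraph V) : Prop :=
  (∀ i j, 0 ≤ A i j) ∧ (∀ i, A i i = 0) ∧ ∀ i j, 0 < A i j ↔ Γ.Adj j i

/-- The jointly connected condition. Node `0` is the leader, node `i.succ` is the follower `i`. -/
def JointlyConnected {N n₀ : ℕ} (σ : SwitchingSignal (Fin n₀))
    (Γ : Fin n₀ → Digraph (Fin (N + 1))) : Prop :=
  ∃ ι : ℕ → ℕ, StrictMono ι ∧ ∃ ε : ℝ, 0 < ε ∧ ∀ k,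
    σ.t (ι (k + 1)) - σ.t (ι k) < ε ∧
    ∀ i : Fin N, Relation.ReflTransGen
      (⨆ j : Ico (ι k) (ι (k + 1)), Γ (σ.σ (σ.t j))).Adj 0 i.succ

/-- The state of the network at one time: positions `q i`, velocities `w i` and parameter
estimates `Θ i` of the followers; for all nodes the observer data `S j`, `η j`, where those of the
leader (node `0`) are its system matrix and its state `v`. -/
structure NetState (N : ℕ) (E F Q : Type) [NormedAddCommGroup E] [InnerProductSpace ℝ E]
    [NormedAddCommGroup F] [InnerProductSpace ℝ F]
    [NormedAddCommGroup Q] [InnerProductSpace ℝ Q] where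
  q : Fin N → E
  w : Fin N → E
  Θ : Fin N → Q
  S : Fin (N + 1) → (F →L[ℝ] F)
  η : Fin (N + 1) → F

/-- What the control law knows: the regression matrices, the leader's output matrix `C` and the
design parameters. It involves neither `M`, `Cor`, `G`, `Θ` nor the leader's matrix `S`. -/
structure AdaptiveLaw (N : ℕ) (E F Q : Type) [NormedAddCommGroup E] [InnerProductSpace ℝ E]
    [NormedAddCommGroup F] [InnerProductSpace ℝ F]
    [NormedAddCommGroup Q] [InnerProductSpace ℝ Q] where
  Y : Fin N → E → E → E → E → (Q →L[ℝ] E)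
  C : F →L[ℝ] E
  μ₁ : ℝ
  μ₂ : ℝ
  α : ℝ
  K : Fin N → (E →L[ℝ] E)
  Λ : Fin N → (Q →L[ℝ] Q)

namespace AdaptiveLaw

variable {N : ℕ}
  {E : Type} [NormedAddCommGroup E] [InnerProductSpace ℝ E] [CompleteSpace E]
  {F : Type} [NormedAddCommGroup F] [InnerProductSpace ℝ F] [CompleteSpace F]
  {Q : Type} [NormedAddCommGroup Q] [InnerProductSpace ℝ Q] [CompleteSpace Q]
  (law : AdaptiveLaw N E F Q)
  (A : Matrix (Fin (N + 1)) (Fin (N + 1)) ℝ) (x : NetState N E F Q) (i : Fin N)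

/-- `Ṡᵢ = μ₁ ∑ⱼ aᵢⱼ (Sⱼ - Sᵢ)`. -/
def SDot : F →L[ℝ] F := law.μ₁ • ∑ j, A i.succ j • (x.S j - x.S i.succ)

/-- `η̇ᵢ = Sᵢ ηᵢ + μ₂ ∑ⱼ aᵢⱼ (ηⱼ - ηᵢ)`. -/
def ηDot : F := x.S i.succ (x.η i.succ) + law.μ₂ • ∑ j, A i.succ j • (x.η j - x.η i.succ)

/-- `q̇ᵣᵢ = C Sᵢ ηᵢ - α (qᵢ - ξᵢ)` with `ξᵢ = C ηᵢ`. -/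
def refVel : E :=
  law.C (x.S i.succ (x.η i.succ)) - law.α • (x.q i - law.C (x.η i.succ))

/-- `q̈ᵣᵢ = C (Ṡᵢ ηᵢ + Sᵢ η̇ᵢ) - α (q̇ᵢ - ξ̇ᵢ)`. -/
def refAcc : E :=
  law.C (law.SDot A x i (x.η i.succ) + x.S i.succ (law.ηDot A x i)) -
    law.α • (x.w i - law.C (law.ηDot A x i))

/-- `sᵢ = q̇ᵢ - q̇ᵣᵢ`. -/
def s : E := x.w i - law.refVel x i

/-- `Yᵢ(qᵢ, q̇ᵢ, q̈ᵣᵢ, q̇ᵣᵢ)`. -/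
def regr : Q →L[ℝ] E := law.Y i (x.q i) (x.w i) (law.refAcc A x i) (law.refVel x i)

/-- `τᵢ = -Kᵢ sᵢ + Yᵢ Θ̂ᵢ`. -/
def torque : E := -(law.K i (law.s x i)) + law.regr A x i (x.Θ i)

/-- The rate of `Θ̂ᵢ`, namely `-Λᵢ⁻¹ Yᵢᵀ sᵢ`. -/
noncomputable def ΘDot : Q :=
  -((law.Λ i).inverse (ContinuousLinearMap.adjoint (law.regr A x i) (law.s x i)))

end AdaptiveLaw

/-- Two states of the network look the same to follower `i` under the digraph `Γ`: its own data
agree, and so do the differences between the observer data of its neighbors and its own. -/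
def SameLocalInfo {N : ℕ}
    {E : Type} [NormedAddCommGroup E] [InnerProductSpace ℝ E] [CompleteSpace E]
    {F : Type} [NormedAddCommGroup F] [InnerProductSpace ℝ F] [CompleteSpace F]
    {Q : Type} [NormedAddCommGroup Q] [InnerProductSpace ℝ Q] [CompleteSpace Q]
    (Γ : Digraph (Fin (N + 1))) (i : Fin N)
    (x x' : NetState N E F Q) : Prop :=
  x.q i = x'.q i ∧ x.w i = x'.w i ∧ x.Θ i = x'.Θ i ∧
  x.S i.succ = x'.S i.succ ∧ x.η i.succ = x'.η i.succ ∧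
  ∀ j, Γ.Adj j i.succ →
    x.S j - x.S i.succ = x'.S j - x'.S i.succ ∧ x.η j - x.η i.succ = x'.η j - x'.η i.succ

/-- The law respects the communication constraint: the torque and the compensator rates of
follower `i` are functions of what is available to it through the digraph `Γ`. -/
def AdaptiveLaw.IsDistributed {N : ℕ}
    {E : Type} [NormedAddCommGroup E] [InnerProductSpace ℝ E] [CompleteSpace E]
    {F : Type} [NormedAddCommGroup F] [InnerProductSpace ℝ F] [CompleteSpace F]
    {Q : Type} [NormedAddCommGroup Q] [InnerProductSpace ℝ Q] [CompleteSpace Q]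
    (law : AdaptiveLaw N E F Q)
    (A : Matrix (Fin (N + 1)) (Fin (N + 1)) ℝ) (Γ : Digraph (Fin (N + 1))) : Prop :=
  ∀ i x x', SameLocalInfo Γ i x x' →
    law.torque A x i = law.torque A x' i ∧ law.ΘDot A x i = law.ΘDot A x' i ∧
    law.SDot A x i = law.SDot A x' i ∧ law.ηDot A x i = law.ηDot A x' i

/-- `f` is continuous on `[0, ∞)` and has the derivative `f'` on each of the intervals
`[tₖ, tₖ₊₁)` between switching instants (a right derivative at `tₖ`). -/
def PiecewiseDeriv {P E : Type} [NormedAddCommGroup E] [NormedSpace ℝ E]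
    (σ : SwitchingSignal P) (f f' : ℝ → E) : Prop :=
  ContinuousOn f (Ici 0) ∧ ∀ k, ∀ t ∈ Ico (σ.t k) (σ.t (k + 1)),
    HasDerivWithinAt f (f' t) (Ico (σ.t k) (σ.t (k + 1))) t

/-- `x` is a trajectory on `[0, ∞)` of the followers `sys` under the control law `law`, together
with the leader `v' = S v` (`v` being the component `η 0` of the state), where `A` gives the
weighted adjacency matrices of the switching network. -/
structure IsClosedLoop {N n₀ : ℕ}
    {E : Type} [NormedAddCommGroup E] [InnerProductSpace ℝ E] [CompleteSpace E]
    {F : Type} [NormedAddCommGroup F] [InnerProductSpace ℝ F] [CompleteSpace F]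
    {Q : Type} [NormedAddCommGroup Q] [InnerProductSpace ℝ Q] [CompleteSpace Q]
    (sys : Fin N → ELSystem E Q) (S : F →L[ℝ] F)
    (law : AdaptiveLaw N E F Q) (σ : SwitchingSignal (Fin n₀))
    (A : Fin n₀ → Matrix (Fin (N + 1)) (Fin (N + 1)) ℝ) (x : ℝ → NetState N E F Q) : Prop where
  leader_S : ∀ t, 0 ≤ t → (x t).S 0 = S
  leader_v : IsLeaderTrajectory S fun t => (x t).η 0
  position : ∀ i, ∀ t, 0 ≤ t →
    HasDerivWithinAt (fun t => (x t).q i) ((x t).w i) (Ici 0) t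
  velocity : ∀ i, ∃ a : ℝ → E, PiecewiseDeriv σ (fun t => (x t).w i) a ∧
    ∀ t, 0 ≤ t →
      (sys i).M ((x t).q i) (a t) + (sys i).Cor ((x t).q i) ((x t).w i) ((x t).w i) +
        (sys i).G ((x t).q i) = law.torque (A (σ.σ t)) (x t) i
  estimate : ∀ i, PiecewiseDeriv σ (fun t => (x t).Θ i) fun t => law.ΘDot (A (σ.σ t)) (x t) i
  observer_S : ∀ i : Fin N, PiecewiseDeriv σ (fun t => (x t).S i.succ)
    fun t => law.SDot (A (σ.σ t)) (x t) i
  observer_η : ∀ i : Fin N, PiecewiseDeriv σ (fun t => (x t).η i.succ)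
    fun t => law.ηDot (A (σ.σ t)) (x t) i

/-!
The proof has two halves, asymptotics and existence, that share the Lyapunov function below.

*Observers.* With `S̃ᵢ = Sᵢ - S` and `η̃ᵢ = ηᵢ - v` the observer errors obey consensus equations with
the leader's component equal to zero,
`S̃ᵢ' = μ₁ ∑ⱼ aᵢⱼ (S̃ⱼ - S̃ᵢ)` and `η̃ᵢ' = S η̃ᵢ + μ₂ ∑ⱼ aᵢⱼ (η̃ⱼ - η̃ᵢ) + S̃ᵢ ηᵢ`.
The largest norm in a consensus network does not increase. Over one window of joint connectivity,
the set of nodes whose norm is below the maximum by a definite fraction gains a node, since some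
edge leaves it for at least the dwell time (`JointlyRooted.exists_superset`); after as many windows
as there are nodes the maximum has contracted (`JointlyRooted.norm_le_contract`). Observability
and the bound on `C S v` give `‖S e^{tS}‖ ≤ B` (`IsObservable.exists_norm_mul_exp_le`), so that
`e^{tS}` grows at most linearly. In the frame moved by `e^{tS}` the drift of `η̃` disappears, and
the exponential contraction beats the linear growth of the frame, even with a perturbation of
vanishing relative size (`JointlyRooted.tendsto_zero`). This theorem gives `(1 + t) S̃ → 0`, as
`y = (1 + t) S̃` is perturbed by `y / (1 + t)` only, and then `η̃ → 0`, as `S̃ᵢ v → 0`.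

*Tracking.* `V = (⟨s, M s⟩ + ⟨Θ̃, Λ Θ̃⟩) / 2` has derivative `-⟨s, K s⟩`
(`IsLoopOn.lyapunov_deriv`), so `s` and the parameter error `Θ̃` are bounded. The position error
`q - C η` is the output of the stable filter `e' = -α e + s - C (consensus term)`; hence it is
bounded, and so are all the arguments of the regressor and the derivative of `s`. Barbalat's
argument (`tendsto_zero_of_dissipation`) gives `s → 0`, the filter gives `q - C η → 0`, and the
claim follows (`IsLoopOn.tendsto_of_observer`).

*Existence.* Between switching instants the closed loop is an autonomous equation with a locally
Lipschitz field. The linear observer equations and `V` bound its solutions a priori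
(`exists_loopField_bound`), so they exist up to the next switching instant
(`exists_solution_of_apriori_bound`), and the pieces are glued (`exists_glued_solution`).

The switching makes the trajectories only piecewise differentiable; all estimates are therefore
made for continuous functions with a right derivative (`RightDerivOn`).
-/

/-! ### Continuous functions with a right derivative -/

/-- `f` is continuous on `[a, b]` and has the right derivative `f'` on `[a, b)`. -/
structure RightDerivOn {X : Type*} [NormedAddCommGroup X] [NormedSpace ℝ X]
    (f f' : ℝ → X) (a b : ℝ) : Prop where
  cont : ContinuousOn f (Icc a b)
  deriv : ∀ t ∈ Ico a b, HasDerivWithinAt f (f' t) (Ici t) t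

namespace RightDerivOn

variable {X Y : Type*} [NormedAddCommGroup X] [NormedSpace ℝ X]
  [NormedAddCommGroup Y] [NormedSpace ℝ Y] {f f' g g' : ℝ → X} {a b : ℝ}

theorem mono (h : RightDerivOn f f' a b) {a' b' : ℝ} (ha : a ≤ a') (hb : b' ≤ b) :
    RightDerivOn f f' a' b' :=
  ⟨h.cont.mono (Icc_subset_Icc ha hb), fun t ht => h.deriv t ⟨ha.trans ht.1, ht.2.trans_le hb⟩⟩

theorem congr_deriv (h : RightDerivOn f f' a b) (hg : ∀ t ∈ Ico a b, f' t = g' t) :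
    RightDerivOn f g' a b :=
  ⟨h.cont, fun t ht => hg t ht ▸ h.deriv t ht⟩

theorem of_hasDerivAt (h : ∀ t ∈ Icc a b, HasDerivAt f (f' t) t) : RightDerivOn f f' a b :=
  ⟨fun t ht => (h t ht).continuousAt.continuousWithinAt,
    fun t ht => (h t (Ico_subset_Icc_self ht)).hasDerivWithinAt⟩

theorem of_hasDerivWithinAt (h : ∀ t ∈ Icc a b, HasDerivWithinAt f (f' t) (Icc a b) t) :
    RightDerivOn f f' a b :=
  ⟨fun t ht => (h t ht).continuousWithinAt, fun t ht =>
    (h t (Ico_subset_Icc_self ht)).mono_of_mem_nhdsWithin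
      (mem_of_superset (Icc_mem_nhdsGE ht.2) (Icc_subset_Icc_left ht.1))⟩

theorem add (hf : RightDerivOn f f' a b) (hg : RightDerivOn g g' a b) :
    RightDerivOn (fun t => f t + g t) (fun t => f' t + g' t) a b :=
  ⟨hf.cont.add hg.cont, fun t ht => (hf.deriv t ht).add (hg.deriv t ht)⟩

theorem sub (hf : RightDerivOn f f' a b) (hg : RightDerivOn g g' a b) :
    RightDerivOn (fun t => f t - g t) (fun t => f' t - g' t) a b :=
  ⟨hf.cont.sub hg.cont, fun t ht => (hf.deriv t ht).sub (hg.deriv t ht)⟩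

theorem clm (L : X →L[ℝ] Y) (hf : RightDerivOn f f' a b) :
    RightDerivOn (fun t => L (f t)) (fun t => L (f' t)) a b :=
  ⟨L.continuous.comp_continuousOn hf.cont,
    fun t ht => L.hasFDerivAt.comp_hasDerivWithinAt t (hf.deriv t ht)⟩

theorem const_smul (c : ℝ) (hf : RightDerivOn f f' a b) :
    RightDerivOn (fun t => c • f t) (fun t => c • f' t) a b :=
  ⟨hf.cont.const_smul c, fun t ht => (hf.deriv t ht).const_smul c⟩

theorem clm_apply {A A' : ℝ → X →L[ℝ] Y} (hA : RightDerivOn A A' a b)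
    (hf : RightDerivOn f f' a b) :
    RightDerivOn (fun t => A t (f t)) (fun t => A' t (f t) + A t (f' t)) a b :=
  ⟨hA.cont.clm_apply hf.cont, fun t ht => (hA.deriv t ht).clm_apply (hf.deriv t ht)⟩

theorem smul {c c' : ℝ → ℝ} (hc : RightDerivOn c c' a b) (hf : RightDerivOn f f' a b) :
    RightDerivOn (fun t => c t • f t) (fun t => c t • f' t + c' t • f t) a b :=
  ⟨hc.cont.smul hf.cont, fun t ht => (hc.deriv t ht).smul (hf.deriv t ht)⟩

theorem pi {V : Type*} [Fintype V] {x x' : ℝ → V → X}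
    (h : ∀ i, RightDerivOn (fun t => x t i) (fun t => x' t i) a b) : RightDerivOn x x' a b :=
  ⟨continuousOn_pi.2 fun i => (h i).cont,
    fun t ht => hasDerivWithinAt_pi.2 fun i => (h i).deriv t ht⟩

theorem apply {V : Type*} [Fintype V] {x x' : ℝ → V → X} (h : RightDerivOn x x' a b) (i : V) :
    RightDerivOn (fun t => x t i) (fun t => x' t i) a b :=
  ⟨continuousOn_pi.1 h.cont i, fun t ht => hasDerivWithinAt_pi.1 (h.deriv t ht) i⟩

theorem norm_sub_le (h : RightDerivOn f f' a b) {c : ℝ} (hc : ∀ t ∈ Ico a b, ‖f' t‖ ≤ c)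
    {t : ℝ} (ht : t ∈ Icc a b) : ‖f t - f a‖ ≤ c * (t - a) :=
  norm_image_sub_le_of_norm_deriv_right_le_segment h.cont h.deriv hc t ht

theorem hasDerivAt_exp_shift (ρ a t : ℝ) :
    HasDerivAt (fun t => Real.exp (ρ * (t - a))) (ρ * Real.exp (ρ * (t - a))) t := by
  have := (((hasDerivAt_id t).sub_const a).const_mul ρ).exp
  simpa [mul_comm] using this

theorem exp_smul (h : RightDerivOn f f' a b) (ρ : ℝ) :
    RightDerivOn (fun t => Real.exp (ρ * (t - a)) • f t)
      (fun t => Real.exp (ρ * (t - a)) • (f' t + ρ • f t)) a b :=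
  ((of_hasDerivAt fun t _ => hasDerivAt_exp_shift ρ a t).smul h).congr_deriv fun t _ => by
    rw [smul_add, smul_smul, mul_comm ρ (Real.exp _)]

/-- If `f` relaxes at rate `ρ` towards values in the ball of radius `β`, then `‖f‖` is bounded by
the corresponding convex combination of its initial value and `β`. -/
theorem norm_le_of_relaxation (h : RightDerivOn f f' a b) {ρ β : ℝ}
    (hb : ∀ t ∈ Ico a b, ‖f' t + ρ • f t‖ ≤ ρ * β) {t : ℝ} (ht : t ∈ Icc a b) :
    ‖f t‖ ≤ Real.exp (-(ρ * (t - a))) * ‖f a‖ + (1 - Real.exp (-(ρ * (t - a)))) * β := by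
  have key := image_norm_le_of_norm_deriv_right_le_deriv_boundary (h.exp_smul ρ).cont
    (h.exp_smul ρ).deriv (B := fun t => ‖f a‖ + (Real.exp (ρ * (t - a)) - 1) * β)
    (B' := fun t => ρ * Real.exp (ρ * (t - a)) * β) (by simp)
    (fun t => (((hasDerivAt_exp_shift ρ a t).sub_const 1).mul_const β).const_add _)
    (fun t ht => by
      rw [norm_smul, Real.norm_eq_abs, abs_of_pos (Real.exp_pos _)]
      nlinarith [hb t ht, Real.exp_pos (ρ * (t - a))]) ht
  rw [norm_smul, Real.norm_eq_abs, abs_of_pos (Real.exp_pos _)] at key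
  have e1 : Real.exp (-(ρ * (t - a))) * Real.exp (ρ * (t - a)) = 1 := by
    rw [← Real.exp_add]; simp
  have := mul_le_mul_of_nonneg_left key (Real.exp_pos (-(ρ * (t - a)))).le
  calc ‖f t‖ = Real.exp (-(ρ * (t - a))) * (Real.exp (ρ * (t - a)) * ‖f t‖) := by
        rw [← mul_assoc, e1, one_mul]
    _ ≤ _ := this
    _ = _ := by linear_combination β * e1

/-- A perturbation of size `π` of a nonexpansive flow moves the norm by at most `π` per unit of
time. -/
theorem norm_le_of_nonexpansive (h : RightDerivOn f f' a b) {ρ π : ℝ}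
    (hb : ∀ t ∈ Ico a b, ‖f' t + ρ • f t‖ ≤ ρ * ‖f t‖ + π) {t : ℝ} (ht : t ∈ Icc a b) :
    ‖f t‖ ≤ ‖f a‖ + π * (t - a) := by
  have key : ∀ π' > π, ‖f t‖ ≤ ‖f a‖ + π' * (t - a) := by
    intro π' hπ'
    have := image_norm_le_of_norm_deriv_right_lt_deriv_boundary (h.exp_smul ρ).cont
      (h.exp_smul ρ).deriv (B := fun t => Real.exp (ρ * (t - a)) * (‖f a‖ + π' * (t - a)))
      (B' := fun t => ρ * Real.exp (ρ * (t - a)) * (‖f a‖ + π' * (t - a)) +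
        Real.exp (ρ * (t - a)) * π') (by simp)
      (fun t => (hasDerivAt_exp_shift ρ a t).mul (by
        simpa using (((hasDerivAt_id t).sub_const a).const_mul π').const_add ‖f a‖))
      (fun t ht hB => by
        rw [norm_smul, Real.norm_eq_abs, abs_of_pos (Real.exp_pos _)] at hB ⊢
        have hpos := Real.exp_pos (ρ * (t - a))
        have hB' := mul_left_cancel₀ hpos.ne' hB
        rw [← hB']
        nlinarith [hb t ht, mul_lt_mul_of_pos_left hπ' hpos,
          mul_le_mul_of_nonneg_left (hb t ht) hpos.le]) ht
    rw [norm_smul, Real.norm_eq_abs, abs_of_pos (Real.exp_pos _)] at this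
    exact le_of_mul_le_mul_left this (Real.exp_pos _)
  refine le_of_forall_pos_le_add fun ε hε => ?_
  have hta : 0 ≤ t - a := sub_nonneg.2 ht.1
  have := key (π + ε / (t - a + 1)) (by have : 0 < t - a + 1 := by linarith
                                        have := div_pos hε this; linarith)
  have h2 : ε / (t - a + 1) * (t - a) ≤ ε := by
    rw [div_mul_eq_mul_div, div_le_iff₀ (by linarith)]; nlinarith
  linarith [add_mul π (ε / (t - a + 1)) (t - a)]

/-- Gronwall's inequality with a crude bound. -/
theorem norm_le_of_linear_growth (h : RightDerivOn f f' a b) {k c : ℝ} (hk : 0 ≤ k) (hc : 0 ≤ c)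
    (hb : ∀ t ∈ Ico a b, ‖f' t‖ ≤ k * ‖f t‖ + c) {t : ℝ} (ht : t ∈ Icc a b) :
    ‖f t‖ ≤ Real.exp (k * (t - a)) * (‖f a‖ + c * (t - a)) := by
  refine (norm_le_gronwallBound_of_norm_deriv_right_le h.cont h.deriv le_rfl hb t ht).trans ?_
  rcases hk.eq_or_lt with rfl | hk
  · simp [gronwallBound_K0]
  · rw [gronwallBound_of_K_ne_0 hk.ne']
    have h1 : Real.exp (k * (t - a)) - 1 ≤ Real.exp (k * (t - a)) * (k * (t - a)) := by
      have := mul_le_mul_of_nonneg_left (Real.add_one_le_exp (-(k * (t - a))))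
        (Real.exp_pos (k * (t - a))).le
      rw [← Real.exp_add] at this
      simp only [add_neg_cancel, Real.exp_zero] at this
      linarith
    have h2 := mul_le_mul_of_nonneg_left h1 (div_nonneg hc hk.le)
    have h3 : c / k * (Real.exp (k * (t - a)) * (k * (t - a))) =
        Real.exp (k * (t - a)) * (c * (t - a)) := by
      field_simp
    linarith

end RightDerivOn

/-! ### Consensus under joint connectivity -/

/-- If `ẋᵢ = ∑ⱼ aⱼ (xⱼ - xᵢ) + p` with total weight at most `ρ`, then `ẋᵢ + ρ xᵢ` is, up to `p`, a
nonnegative combination of the `xⱼ` with total weight `ρ`. A node `j` of norm at most `μ` and of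
weight at least `w` lowers the resulting bound on its norm. -/
theorem norm_consensus_relax {V X : Type*} [Fintype V] [NormedAddCommGroup X] [NormedSpace ℝ X]
    {a : V → ℝ} (ha : ∀ j, 0 ≤ a j) {ρ : ℝ} (hρ : ∑ j, a j ≤ ρ) {x : V → X} {m : ℝ}
    (hx : ∀ j, ‖x j‖ ≤ m) {i j : V} {w μ : ℝ} (hw : 0 ≤ w) (hwa : w ≤ a j) (hμ : ‖x j‖ ≤ μ)
    {p : X} {π : ℝ} (hp : ‖p‖ ≤ π) :
    ‖(∑ j, a j • (x j - x i) + p) + ρ • x i‖ ≤ ρ * m - w * (m - μ) + π := by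
  have e : (∑ j, a j • (x j - x i) + p) + ρ • x i =
      (∑ j, a j • x j + (ρ - ∑ j, a j) • x i) + p := by
    simp only [smul_sub, Finset.sum_sub_distrib, sub_smul, Finset.sum_smul]; abel
  rw [e]
  have h1 : ‖∑ j, a j • x j‖ ≤ ∑ j, a j * m - w * (m - μ) := by
    classical
    refine (norm_sum_le _ _).trans ?_
    have : ∀ k ∈ Finset.univ, ‖a k • x k‖ ≤ a k * m - if k = j then w * (m - μ) else 0 := by
      intro k _
      rw [norm_smul, Real.norm_eq_abs, abs_of_nonneg (ha k)]
      split_ifs with hk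
      · subst hk
        nlinarith [mul_le_mul_of_nonneg_left (hx k) (sub_nonneg.2 hwa),
          mul_le_mul_of_nonneg_left hμ hw]
      · simpa using mul_le_mul_of_nonneg_left (hx k) (ha k)
    simpa using Finset.sum_le_sum this
  have h2 : ‖(ρ - ∑ j, a j) • x i‖ ≤ (ρ - ∑ j, a j) * m := by
    rw [norm_smul, Real.norm_eq_abs, abs_of_nonneg (sub_nonneg.2 hρ)]
    exact mul_le_mul_of_nonneg_left (hx i) (sub_nonneg.2 hρ)
  have := (norm_add_le _ p).trans (add_le_add ((norm_add_le _ _).trans (add_le_add h1 h2)) hp)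
  rw [← Finset.sum_mul] at this
  linarith

/-- Time varying consensus weights with joint connectivity: `a t i j ≥ 0` is the weight of the edge
from `j` to `i` at time `t`, the in-degrees are at most `ρ`, and during each of the windows
`[T k, T (k + 1)]`, of length at most `ε`, every proper set of nodes that contains the root `r` has
an outgoing edge whose weight is at least `w` for a time `τ`. -/
structure JointlyRooted {V : Type*} [Fintype V] (a : ℝ → V → V → ℝ) (r : V) (T : ℕ → ℝ)
    (ρ ε τ w : ℝ) : Prop where
  nonneg : ∀ t i j, 0 ≤ a t i j
  degree : ∀ t i, ∑ j, a t i j ≤ ρ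
  w_pos : 0 < w
  w_le : 2 * w ≤ ρ
  τ_pos : 0 < τ
  T_nonneg : 0 ≤ T 0
  T_lt : ∀ k, T k < T (k + 1)
  T_le : ∀ k, T (k + 1) ≤ T k + ε
  T_tendsto : Tendsto T atTop atTop
  edge : ∀ k (R : Set V), r ∈ R → R ≠ univ → ∃ i ∉ R, ∃ j ∈ R, ∃ b, T k ≤ b ∧ b + τ ≤ T (k + 1) ∧
    ∀ t ∈ Ico b (b + τ), w ≤ a t i j

namespace JointlyRooted

variable {V X : Type*} [Fintype V] [NormedAddCommGroup X] [NormedSpace ℝ X]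
  {a : ℝ → V → V → ℝ} {r : V} {T : ℕ → ℝ} {ρ ε τ w : ℝ}

theorem ρ_pos (h : JointlyRooted a r T ρ ε τ w) : 0 < ρ := by
  linarith [h.w_pos, h.w_le]

theorem ε_pos (h : JointlyRooted a r T ρ ε τ w) : 0 < ε := by
  linarith [h.T_lt 0, h.T_le 0]

theorem T_mono (h : JointlyRooted a r T ρ ε τ w) : Monotone T :=
  monotone_nat_of_le_succ fun k => (h.T_lt k).le

theorem T_nonneg' (h : JointlyRooted a r T ρ ε τ w) (k : ℕ) : 0 ≤ T k :=
  h.T_nonneg.trans (h.T_mono k.zero_le)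

theorem T_add_le (h : JointlyRooted a r T ρ ε τ w) (k n : ℕ) : T (k + n) ≤ T k + n * ε := by
  induction n with
  | zero => simp
  | succ n ih => rw [← add_assoc]; push_cast; linarith [h.T_le (k + n)]

/-- In a perturbed consensus system the maximum of the norms grows at most at the rate of the
perturbation. -/
theorem norm_le_add (h : JointlyRooted a r T ρ ε τ w) {x : ℝ → V → X} {p : ℝ → V → X} {s e π : ℝ}
    (hx : RightDerivOn x (fun t i => ∑ j, a t i j • (x t j - x t i) + p t i) s e) (hπ : 0 ≤ π)
    (hp : ∀ t ∈ Ico s e, ∀ i, ‖p t i‖ ≤ π) {t : ℝ} (ht : t ∈ Icc s e) :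
    ‖x t‖ ≤ ‖x s‖ + π * (t - s) := by
  refine hx.norm_le_of_nonexpansive (ρ := ρ) (fun t ht => ?_) ht
  refine (pi_norm_le_iff_of_nonneg (by have := h.ρ_pos; positivity)).2 fun i => ?_
  have := norm_consensus_relax (h.nonneg t i) (h.degree t i) (norm_le_pi_norm (x t)) (i := i)
    (j := r) le_rfl (h.nonneg t i r) (norm_le_pi_norm (x t) r) (hp t ht i)
  simpa using this

/-- The relaxation of node `i`, where `j` is a neighbor of smaller norm. The bound `M` exceeds the
norms by so much that it absorbs the perturbation. -/
theorem norm_node_le (h : JointlyRooted a r T ρ ε τ w) {x : ℝ → V → X} {p : ℝ → V → X}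
    {s e m π M : ℝ}
    (hx : RightDerivOn x (fun t i => ∑ j, a t i j • (x t j - x t i) + p t i) s e)
    (hp : ∀ t ∈ Ico s e, ∀ i, ‖p t i‖ ≤ π) (hm : ∀ t ∈ Ico s e, ∀ i, ‖x t i‖ ≤ m)
    (hM : ρ * m + 2 * π ≤ ρ * M) (hmM : m ≤ M) {i j : V} {w' δ γ : ℝ} (hw' : 0 ≤ w')
    (hw'ρ : 2 * w' ≤ ρ)
    (hj : ∀ t ∈ Ico s e, w' ≤ a t i j ∧ ‖x t j‖ ≤ (1 - γ) * M)
    (hi : ‖x s i‖ ≤ (1 - δ) * M) {t : ℝ} (ht : t ∈ Icc s e) :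
    ‖x t i‖ ≤ (1 - (Real.exp (-(ρ * (t - s))) * δ +
      (1 - Real.exp (-(ρ * (t - s)))) * (w' * γ / ρ))) * M := by
  have hρ := h.ρ_pos
  have := (hx.apply i).norm_le_of_relaxation (ρ := ρ) (β := M - w' * γ / ρ * M) (fun t ht => by
    have e : ρ * (M - w' * γ / ρ * M) = ρ * M - w' * (γ * M) := by field_simp
    rw [e]
    obtain ⟨h1, h2⟩ := hj t ht
    have h3 := norm_consensus_relax (h.nonneg t i) (h.degree t i) (hm t ht) (i := i) (j := j)
      hw' h1 h2 (hp t ht i)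
    nlinarith [mul_le_mul_of_nonneg_right hw'ρ (sub_nonneg.2 hmM)]) ht
  have := this.trans (add_le_add_left (mul_le_mul_of_nonneg_left hi (Real.exp_pos _).le) _)
  linarith

/-- A node with norm at most `(1 - δ) M` keeps, up to an exponential factor, its distance
from `M`. -/
theorem norm_node_le_of_le (h : JointlyRooted a r T ρ ε τ w) {x : ℝ → V → X} {p : ℝ → V → X}
    {s e m π M : ℝ}
    (hx : RightDerivOn x (fun t i => ∑ j, a t i j • (x t j - x t i) + p t i) s e)
    (hp : ∀ t ∈ Ico s e, ∀ i, ‖p t i‖ ≤ π) (hm : ∀ t ∈ Ico s e, ∀ i, ‖x t i‖ ≤ m)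
    (hM : ρ * m + 2 * π ≤ ρ * M) (hmM : m ≤ M) (hM0 : 0 ≤ M) (hse : e ≤ s + ε)
    {i : V} {δ : ℝ} (hδ : 0 ≤ δ)
    (hi : ‖x s i‖ ≤ (1 - δ) * M) {t : ℝ} (ht : t ∈ Icc s e) :
    ‖x t i‖ ≤ (1 - Real.exp (-(ρ * ε)) * δ) * M := by
  have := h.norm_node_le hx hp hm hM hmM (j := i) (γ := 0) le_rfl (by linarith [h.ρ_pos])
    (fun t ht => ⟨h.nonneg t i i, by linarith [hm t ht i]⟩) hi ht
  simp only [zero_div, mul_zero, add_zero] at this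
  refine this.trans ?_
  have : Real.exp (-(ρ * ε)) ≤ Real.exp (-(ρ * (t - s))) :=
    Real.exp_le_exp.2 (by nlinarith [h.ρ_pos, ht.2])
  gcongr

/-- The factor by which the margin `δ` shrinks per window. -/
noncomputable def rate (ρ ε τ w : ℝ) : ℝ :=
  Real.exp (-(ρ * ε)) * Real.exp (-(ρ * ε)) * ((1 - Real.exp (-(ρ * τ))) * (w / ρ))

theorem rate_pos (h : JointlyRooted a r T ρ ε τ w) : 0 < rate ρ ε τ w := by
  have h1 : Real.exp (-(ρ * τ)) < 1 :=
    Real.exp_lt_one_iff.2 (by have := mul_pos h.ρ_pos h.τ_pos; linarith)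
  have h2 := div_pos h.w_pos h.ρ_pos
  have := sub_pos.2 h1
  unfold rate
  positivity

theorem gain_le_one (h : JointlyRooted a r T ρ ε τ w) :
    (1 - Real.exp (-(ρ * τ))) * (w / ρ) ≤ 1 := by
  have h2 : w / ρ ≤ 1 := (div_le_one h.ρ_pos).2 (by linarith [h.w_le, h.w_pos])
  have h3 : 0 ≤ w / ρ := (div_pos h.w_pos h.ρ_pos).le
  have := Real.exp_pos (-(ρ * τ))
  nlinarith

theorem exp_le_one (h : JointlyRooted a r T ρ ε τ w) : Real.exp (-(ρ * ε)) ≤ 1 :=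
  Real.exp_le_one_iff.2 (by have := mul_pos h.ρ_pos h.ε_pos; linarith)

theorem rate_le (h : JointlyRooted a r T ρ ε τ w) : rate ρ ε τ w ≤ Real.exp (-(ρ * ε)) := by
  have h0 := Real.exp_pos (-(ρ * ε))
  have h1 := h.gain_le_one
  have h2 := h.exp_le_one
  unfold rate
  calc _ ≤ Real.exp (-(ρ * ε)) * Real.exp (-(ρ * ε)) * 1 := by gcongr
    _ ≤ Real.exp (-(ρ * ε)) * 1 * 1 := by gcongr
    _ = _ := by ring

theorem rate_le_one (h : JointlyRooted a r T ρ ε τ w) : rate ρ ε τ w ≤ 1 :=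
  h.rate_le.trans h.exp_le_one

/-- In each window a set of nodes with norms at most `(1 - δ) M` gains a node, at the expense of a
smaller margin `δ`. -/
theorem exists_superset (h : JointlyRooted a r T ρ ε τ w) {x : ℝ → V → X} {p : ℝ → V → X}
    {k : ℕ} {m π M : ℝ}
    (hx : RightDerivOn x (fun t i => ∑ j, a t i j • (x t j - x t i) + p t i) (T k) (T (k + 1)))
    (hp : ∀ t ∈ Ico (T k) (T (k + 1)), ∀ i, ‖p t i‖ ≤ π)
    (hm : ∀ t ∈ Icc (T k) (T (k + 1)), ∀ i, ‖x t i‖ ≤ m)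
    (hM : ρ * m + 2 * π ≤ ρ * M) (hmM : m ≤ M) (hM0 : 0 ≤ M)
    {R : Finset V} (hr : r ∈ R) {δ : ℝ} (hδ : 0 ≤ δ) (hR : ∀ i ∈ R, ‖x (T k) i‖ ≤ (1 - δ) * M) :
    ∃ R' : Finset V, R ⊆ R' ∧ (R' = Finset.univ ∨ R.card < R'.card) ∧
      ∀ i ∈ R', ‖x (T (k + 1)) i‖ ≤ (1 - rate ρ ε τ w * δ) * M := by
  classical
  have hm' : ∀ t ∈ Ico (T k) (T (k + 1)), ∀ i, ‖x t i‖ ≤ m :=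
    fun t ht => hm t (Ico_subset_Icc_self ht)
  have old : ∀ i ∈ R, ‖x (T (k + 1)) i‖ ≤ (1 - rate ρ ε τ w * δ) * M := fun i hi => by
    refine (h.norm_node_le_of_le hx hp hm' hM hmM hM0 (h.T_le k) hδ (hR i hi)
      (right_mem_Icc.2 (h.T_lt k).le)).trans ?_
    have := h.rate_le
    gcongr
  by_cases hu : R = Finset.univ
  · exact ⟨R, subset_rfl, Or.inl hu, old⟩
  obtain ⟨i, hi, j, hj, b, hb, hb', hw⟩ := h.edge k (R : Set V) (by simpa using hr)
    (by simpa [Finset.coe_eq_univ] using hu)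
  have hτ := h.τ_pos
  have h1 : ∀ t ∈ Ico b (b + τ), w ≤ a t i j ∧ ‖x t j‖ ≤ (1 - Real.exp (-(ρ * ε)) * δ) * M :=
    fun t ht => ⟨hw t ht, h.norm_node_le_of_le hx hp hm' hM hmM hM0 (h.T_le k) hδ
      (hR j (by simpa using hj)) ⟨hb.trans ht.1, ht.2.le.trans hb'⟩⟩
  have sub1 : Ico b (b + τ) ⊆ Ico (T k) (T (k + 1)) := Ico_subset_Ico hb hb'
  have sub2 : Ico (b + τ) (T (k + 1)) ⊆ Ico (T k) (T (k + 1)) :=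
    Ico_subset_Ico_left (by linarith)
  have h2 := h.norm_node_le (hx.mono hb hb') (fun t ht => hp t (sub1 ht))
    (fun t ht => hm' t (sub1 ht)) hM hmM (δ := 0) h.w_pos.le h.w_le h1
    (by linarith [hm b ⟨hb, by linarith⟩ i]) (right_mem_Icc.2 (by linarith))
  have h3 := h.norm_node_le_of_le (hx.mono (by linarith : T k ≤ b + τ) le_rfl)
    (fun t ht => hp t (sub2 ht))
    (fun t ht => hm' t (sub2 ht)) hM hmM hM0 (by linarith [h.T_le k])
    (δ := (1 - Real.exp (-(ρ * τ))) * (w / ρ) * (Real.exp (-(ρ * ε)) * δ))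
    (by
      have h1 : Real.exp (-(ρ * τ)) ≤ 1 :=
        Real.exp_le_one_iff.2 (by have := mul_pos h.ρ_pos h.τ_pos; linarith)
      have h2 := (div_pos h.w_pos h.ρ_pos).le
      have := sub_nonneg.2 h1
      positivity)
    (i := i) (by
      refine h2.trans (le_of_eq ?_)
      rw [add_sub_cancel_left]
      ring) (right_mem_Icc.2 hb')
  refine ⟨insert i R, Finset.subset_insert _ _, Or.inr ?_, fun l hl => ?_⟩
  · rw [Finset.card_insert_of_notMem (by simpa using hi)]; exact Nat.lt_succ_self _
  · rcases Finset.mem_insert.1 hl with rfl | hl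
    · refine h3.trans (le_of_eq ?_)
      unfold rate
      ring
    · exact old l hl

/-- After as many windows as there are nodes the perturbed consensus system has contracted. -/
theorem norm_le_contract (h : JointlyRooted a r T ρ ε τ w) {x : ℝ → V → X} {p : ℝ → V → X}
    {k : ℕ} {m π M : ℝ}
    (hx : RightDerivOn x (fun t i => ∑ j, a t i j • (x t j - x t i) + p t i)
      (T k) (T (k + Fintype.card V)))
    (hp : ∀ t ∈ Ico (T k) (T (k + Fintype.card V)), ∀ i, ‖p t i‖ ≤ π)
    (hm : ∀ t ∈ Icc (T k) (T (k + Fintype.card V)), ∀ i, ‖x t i‖ ≤ m)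
    (hM : ρ * m + 2 * π ≤ ρ * M) (hmM : m ≤ M) (hM0 : 0 ≤ M) (hr : ∀ t, 0 ≤ t → x t r = 0) :
    ‖x (T (k + Fintype.card V))‖ ≤ (1 - rate ρ ε τ w ^ Fintype.card V) * M := by
  classical
  have key : ∀ n ≤ Fintype.card V, ∃ R : Finset V, r ∈ R ∧ (R = Finset.univ ∨ n < R.card) ∧
      ∀ i ∈ R, ‖x (T (k + n)) i‖ ≤ (1 - rate ρ ε τ w ^ n) * M := by
    intro n
    induction n with
    | zero =>
      intro _
      refine ⟨{r}, by simp, Or.inr (by simp), ?_⟩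
      simp [hr _ (h.T_nonneg' k)]
    | succ n ih =>
      intro hn
      obtain ⟨R, hrR, hc, hR⟩ := ih (by omega)
      have l1 : T k ≤ T (k + n) := h.T_mono (by omega)
      have l2 : T (k + n + 1) ≤ T (k + Fintype.card V) := h.T_mono (by omega)
      obtain ⟨R', hs, hc', hR'⟩ := h.exists_superset (hx.mono l1 l2)
        (fun t ht => hp t (Ico_subset_Ico l1 l2 ht))
        (fun t ht => hm t (Icc_subset_Icc l1 l2 ht)) hM hmM hM0 hrR
        (pow_nonneg h.rate_pos.le n) hR
      refine ⟨R', hs hrR, ?_, fun i hi => ?_⟩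
      · rcases hc' with hc' | hc'
        · exact Or.inl hc'
        · rcases hc with rfl | hc
          · exact Or.inl (Finset.univ_subset_iff.1 hs)
          · exact Or.inr (by omega)
      · have := hR' i hi
        rw [← pow_succ'] at this
        exact this
  obtain ⟨R, -, hc, hR⟩ := key _ le_rfl
  have hu : R = Finset.univ := by
    rcases hc with hc | hc
    · exact hc
    · exact absurd (Finset.card_le_univ R) (not_le.2 hc)
  have := pow_le_one₀ (n := Fintype.card V) h.rate_pos.le h.rate_le_one
  exact (pi_norm_le_iff_of_nonneg (mul_nonneg (by linarith) hM0)).2 fun i => hR i (by simp [hu])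

end JointlyRooted

/-! ### Convergence of consensus with a drift and a perturbation -/

/-- An increasing sequence of times tending to infinity splits the half line into intervals. -/
theorem exists_mem_Ico_of_tendsto_atTop {T : ℕ → ℝ} (hT : Tendsto T atTop atTop) {k : ℕ} {t : ℝ}
    (hk : T k ≤ t) : ∃ j ≥ k, t ∈ Ico (T j) (T (j + 1)) := by
  classical
  have hex : ∃ n, t < T (k + n) := by
    obtain ⟨n, hn⟩ := ((hT.comp (tendsto_add_atTop_nat k)).eventually_gt_atTop t).exists
    exact ⟨n, by simpa [add_comm] using hn⟩
  have h0 : Nat.find hex ≠ 0 := fun h => by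
    have := Nat.find_spec hex
    rw [h] at this
    exact absurd hk (not_le.2 (by simpa using this))
  obtain ⟨n, hn⟩ := Nat.exists_eq_succ_of_ne_zero h0
  refine ⟨k + n, by omega, not_lt.1 (Nat.find_min hex (by omega)), ?_⟩
  have := Nat.find_spec hex
  rwa [hn] at this

theorem tendsto_zero_of_le_half_add {W : ℕ → ℝ} (hW : ∀ j, 0 ≤ W j) {C : ℝ} (hC : 0 < C)
    (h : ∀ ε > 0, ε ≤ 1 → ∀ᶠ j in atTop, W (j + 1) ≤ W j / 2 + C * ε * (W j + 1)) :
    Tendsto W atTop (𝓝 0) := by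
  refine Metric.tendsto_atTop.2 fun δ hδ => ?_
  obtain ⟨ε, hε, h1, h2, h3⟩ : ∃ ε : ℝ, 0 < ε ∧ ε ≤ 1 ∧ C * ε ≤ 1 / 4 ∧ 8 * (C * ε) ≤ δ := by
    refine ⟨min 1 (min (1 / (4 * C)) (δ / (8 * C))), by positivity, min_le_left _ _, ?_, ?_⟩
    · have : min 1 (min (1 / (4 * C)) (δ / (8 * C))) ≤ 1 / (4 * C) :=
        (min_le_right _ _).trans (min_le_left _ _)
      calc C * _ ≤ C * (1 / (4 * C)) := by gcongr
        _ = _ := by field_simp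
    · have : min 1 (min (1 / (4 * C)) (δ / (8 * C))) ≤ δ / (8 * C) :=
        (min_le_right _ _).trans (min_le_right _ _)
      calc 8 * (C * _) ≤ 8 * (C * (δ / (8 * C))) := by gcongr
        _ = _ := by field_simp
  obtain ⟨J, hJ⟩ := eventually_atTop.1 (h ε hε h1)
  have key : ∀ n, W (J + n) ≤ (3 / 4) ^ n * W J + 4 * (C * ε) := by
    intro n
    induction n with
    | zero => simp; positivity
    | succ n ih =>
      have := hJ (J + n) (by omega)
      rw [← add_assoc, pow_succ]
      nlinarith [hW (J + n), mul_le_mul_of_nonneg_right h2 (hW (J + n))]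
  have h4 : Tendsto (fun n : ℕ => (3 / 4 : ℝ) ^ n * W J) atTop (𝓝 0) := by
    simpa using (tendsto_pow_atTop_nhds_zero_of_lt_one (by norm_num : (0 : ℝ) ≤ 3 / 4)
      (by norm_num)).mul_const (W J)
  obtain ⟨n₀, hn₀⟩ := eventually_atTop.1 (h4.eventually_lt_const (half_pos hδ))
  refine ⟨J + n₀, fun n hn => ?_⟩
  obtain ⟨i, rfl⟩ := Nat.exists_eq_add_of_le (show J ≤ n by omega)
  rw [dist_zero_right, Real.norm_eq_abs, abs_of_nonneg (hW _)]
  linarith [key i, hn₀ i (by omega)]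

theorem hasDerivAt_exp_sub_smul {X : Type*} [NormedAddCommGroup X] [NormedSpace ℝ X]
    [CompleteSpace X] (D : X →L[ℝ] X) (s t : ℝ) :
    HasDerivAt (fun t : ℝ => NormedSpace.exp ((s - t) • D))
      (-(NormedSpace.exp ((s - t) • D) * D)) t := by
  have := (hasDerivAt_exp_smul_const (𝕂 := ℝ) D (s - t)).scomp t ((hasDerivAt_id t).const_sub s)
  simp only [neg_smul, one_smul] at this
  exact this

theorem exp_smul_mul_exp_smul {X : Type*} [NormedAddCommGroup X] [NormedSpace ℝ X]
    [CompleteSpace X] (D : X →L[ℝ] X) (s t : ℝ) :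
    NormedSpace.exp (s • D) * NormedSpace.exp (t • D) = NormedSpace.exp ((s + t) • D) := by
  let +nondep : NormedAlgebra ℚ (X →L[ℝ] X) := NormedAlgebra.restrictScalars ℚ ℝ _
  rw [add_smul, NormedSpace.exp_add_of_commute]
  exact ((Commute.refl D).smul_left s).smul_right t

namespace JointlyRooted

variable {V X : Type*} [Fintype V] [NormedAddCommGroup X] [NormedSpace ℝ X]
  {a : ℝ → V → V → ℝ} {r : V} {T : ℕ → ℝ} {ρ ε τ w : ℝ}

theorem rate_pow_card_lt_one (h : JointlyRooted a r T ρ ε τ w) :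
    1 - rate ρ ε τ w ^ Fintype.card V < 1 := by
  linarith [pow_pos h.rate_pos (Fintype.card V)]

theorem rate_pow_card_nonneg (h : JointlyRooted a r T ρ ε τ w) :
    0 ≤ 1 - rate ρ ε τ w ^ Fintype.card V :=
  sub_nonneg.2 (pow_le_one₀ h.rate_pos.le h.rate_le_one)

/-- `L`-fold iteration of `norm_le_contract`. -/
theorem norm_le_contract_iterate (h : JointlyRooted a r T ρ ε τ w) {x : ℝ → V → X}
    {p : ℝ → V → X} {k : ℕ} {π : ℝ} (hπ : 0 ≤ π) (L : ℕ)
    (hx : RightDerivOn x (fun t i => ∑ j, a t i j • (x t j - x t i) + p t i)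
      (T k) (T (k + L * Fintype.card V)))
    (hp : ∀ t ∈ Ico (T k) (T (k + L * Fintype.card V)), ∀ i, ‖p t i‖ ≤ π)
    (hr : ∀ t, 0 ≤ t → x t r = 0) :
    ‖x (T (k + L * Fintype.card V))‖ ≤ (1 - rate ρ ε τ w ^ Fintype.card V) ^ L * ‖x (T k)‖ +
      L * ((Fintype.card V * ε + 2 / ρ) * π) := by
  have hρ := h.ρ_pos
  have hε := h.ε_pos
  induction L with
  | zero => simp
  | succ L ih =>
    set n := Fintype.card V with hn
    have e1 : k + (L + 1) * n = k + L * n + n := by ring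
    rw [e1] at hx hp ⊢
    have l1 : T k ≤ T (k + L * n) := h.T_mono (by omega)
    have l2 : T (k + L * n) ≤ T (k + L * n + n) := h.T_mono (by omega)
    have ih := ih (hx.mono le_rfl l2) fun t ht => hp t (Ico_subset_Ico le_rfl l2 ht)
    have h2 := h.norm_le_contract (k := k + L * n) (π := π)
      (m := ‖x (T (k + L * n))‖ + π * (n * ε))
      (M := ‖x (T (k + L * n))‖ + π * (n * ε) + 2 / ρ * π)
      (hx.mono l1 le_rfl) (fun t ht => hp t (Ico_subset_Ico l1 le_rfl ht))
      (fun t ht i => (norm_le_pi_norm _ i).trans ((h.norm_le_add (hx.mono l1 le_rfl) hπ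
        (fun t ht => hp t (Ico_subset_Ico l1 le_rfl ht)) ht).trans (by
          have : t - T (k + L * n) ≤ n * ε := by linarith [ht.2, h.T_add_le (k + L * n) n]
          gcongr)))
      (le_of_eq (by field_simp)) (by linarith [show 0 ≤ 2 / ρ * π by positivity]) (by positivity) hr
    rw [← hn] at h2
    have hκ := h.rate_pow_card_nonneg
    have hκ1 := h.rate_pow_card_lt_one.le
    set κ := 1 - rate ρ ε τ w ^ n
    have h3 : 0 ≤ (n * ε + 2 / ρ) * π := by positivity
    rw [show ‖x (T (k + L * n))‖ + π * (n * ε) + 2 / ρ * π =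
      ‖x (T (k + L * n))‖ + (n * ε + 2 / ρ) * π by ring] at h2
    refine h2.trans ((mul_le_mul_of_nonneg_left (add_le_add_left ih _) hκ).trans ?_)
    push_cast
    have h4 : κ * ((L + 1) * ((n * ε + 2 / ρ) * π)) ≤ 1 * ((L + 1) * ((n * ε + 2 / ρ) * π)) := by
      gcongr
    rw [pow_succ]
    linarith

/-- A crude growth estimate for a perturbed consensus system with a drift. -/
theorem norm_le_of_drift (h : JointlyRooted a r T ρ ε τ w) {D : X →L[ℝ] X} {x p : ℝ → V → X}
    {b c e : ℝ}
    (hx : RightDerivOn x (fun t i => D (x t i) + ∑ j, a t i j • (x t j - x t i) + p t i) b c)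
    (he : 0 ≤ e) (he1 : e ≤ 1) (hp : ∀ t ∈ Ico b c, ∀ i, ‖p t i‖ ≤ e * (‖x t‖ + 1)) {t : ℝ}
    (ht : t ∈ Icc b c) :
    ‖x t‖ ≤ Real.exp ((‖D‖ + 2 * ρ + 1) * (t - b)) * (‖x b‖ + e * (t - b)) := by
  have hρ := h.ρ_pos
  refine hx.norm_le_of_linear_growth (by positivity) he (fun t ht => ?_) ht
  refine (pi_norm_le_iff_of_nonneg (by positivity)).2 fun i => ?_
  have h1 := norm_consensus_relax (h.nonneg t i) (h.degree t i) (norm_le_pi_norm (x t))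
    (i := i) (j := r) le_rfl (h.nonneg t i r) (norm_le_pi_norm (x t) r) (p := 0) (π := 0)
    (by simp)
  have h2 := hp t ht i
  have h3 := D.le_opNorm (x t i)
  have h4 := norm_le_pi_norm (x t) i
  have h5 : D (x t i) + ∑ j, a t i j • (x t j - x t i) + p t i = D (x t i) +
      (((∑ j, a t i j • (x t j - x t i) + 0) + ρ • x t i) - ρ • x t i) + p t i := by abel
  rw [h5]
  refine (norm_add_le _ _).trans ((add_le_add_left ((norm_add_le _ _).trans
    (add_le_add_right (norm_sub_le _ _) _)) _).trans ?_)
  rw [norm_smul, Real.norm_eq_abs, abs_of_pos hρ]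
  nlinarith [mul_le_mul_of_nonneg_left h4 (norm_nonneg D), norm_nonneg (x t),
    mul_le_mul_of_nonneg_left h4 hρ.le]

/-- Over a block of sufficiently many windows a consensus system with a drift `D` contracts up to
the perturbation: in the frame moved by the flow of `D` it contracts exponentially in the number of
windows, and this beats the linear growth of the flow. -/
theorem exists_block_estimate [CompleteSpace X] (h : JointlyRooted a r T ρ ε τ w) {D : X →L[ℝ] X}
    {B : ℝ} (hB : 0 ≤ B) (hD : ∀ t, 0 ≤ t → ‖NormedSpace.exp (t • D)‖ ≤ 1 + B * t)
    {x p : ℝ → V → X} (hx : ∀ b, RightDerivOn x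
      (fun t i => D (x t i) + ∑ j, a t i j • (x t j - x t i) + p t i) 0 b)
    (hr : ∀ t, 0 ≤ t → x t r = 0) {η : ℝ → ℝ}
    (hp : ∀ t, 0 ≤ t → ∀ i, ‖p t i‖ ≤ η t * (‖x t‖ + 1)) :
    ∃ P : ℕ, 0 < P ∧ ∃ G > 0, ∃ C > 0, ∀ k, ∀ e > 0, e ≤ 1 → (∀ t ≥ T k, η t ≤ e) →
      (∀ t ∈ Icc (T k) (T (k + P)), ‖x t‖ ≤ G * (‖x (T k)‖ + e)) ∧
      ‖x (T (k + P))‖ ≤ ‖x (T k)‖ / 2 + C * e * (‖x (T k)‖ + 1) := by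
  have hρ := h.ρ_pos
  have hε := h.ε_pos
  set n := Fintype.card V with hn
  set κ := 1 - rate ρ ε τ w ^ n with hκdef
  have hκ : 0 ≤ κ := h.rate_pow_card_nonneg
  have hκ1 : κ < 1 := h.rate_pow_card_lt_one
  -- the number of repetitions after which the contraction beats the growth of the flow of `D`
  obtain ⟨L, hL⟩ : ∃ L : ℕ, (1 + B * (L * (n * ε))) * κ ^ L ≤ 1 / 2 := by
    have h1 : Tendsto (fun L : ℕ => κ ^ L + B * (n * ε) * (L * κ ^ L)) atTop (𝓝 0) := by
      simpa using (tendsto_pow_atTop_nhds_zero_of_lt_one hκ hκ1).add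
        ((tendsto_self_mul_const_pow_of_lt_one hκ hκ1).const_mul (B * (n * ε)))
    obtain ⟨L, hL⟩ := (h1.eventually_lt_const (show (0 : ℝ) < 1 / 2 by norm_num)).exists
    exact ⟨L, by linarith⟩
  set P := L * n with hP
  have hPpos : 0 < P := by
    have : 0 < n := Fintype.card_pos_iff.2 ⟨r⟩
    rcases Nat.eq_zero_or_pos L with rfl | hL0
    · norm_num at hL
    · positivity
  set H : ℝ := L * (n * ε) with hH
  have hH0 : 0 ≤ H := by positivity
  have hTP : ∀ k, T (k + P) - T k ≤ H := fun k => by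
    have := h.T_add_le k P
    rw [hP] at this ⊢
    push_cast at this
    linarith
  -- crude growth within a block of windows
  set G := Real.exp ((‖D‖ + 2 * ρ + 1) * H) * (1 + H) with hG
  have hG0 : 0 < G := by positivity
  have crude : ∀ k, ∀ e > 0, e ≤ 1 → (∀ t ≥ T k, η t ≤ e) → ∀ t ∈ Icc (T k) (T (k + P)),
      ‖x t‖ ≤ G * (‖x (T k)‖ + e) := fun k e he he1 hηe t ht => by
    have h1 := h.norm_le_of_drift ((hx (T (k + P))).mono (h.T_nonneg' k) le_rfl) he.le he1
      (fun t ht i => (hp t ((h.T_nonneg' k).trans ht.1) i).trans (by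
        have := hηe t ht.1
        gcongr)) ht
    refine h1.trans ?_
    have h2 : t - T k ≤ H := by linarith [ht.2, hTP k]
    have h3 : 0 ≤ t - T k := by linarith [ht.1]
    rw [hG, mul_assoc]
    have : ‖x (T k)‖ + e * (t - T k) ≤ (1 + H) * (‖x (T k)‖ + e) := by
      nlinarith [norm_nonneg (x (T k)), mul_le_mul_of_nonneg_left h2 he.le,
        mul_nonneg hH0 (norm_nonneg (x (T k)))]
    gcongr
  -- contraction over a block of windows
  obtain ⟨F, hF0, hF⟩ : ∃ F : ℝ, 0 < F ∧ ∀ u ∈ Icc (-H) 0, ‖NormedSpace.exp (u • D)‖ ≤ F := by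
    obtain ⟨F, hF⟩ := (isCompact_Icc (a := -H) (b := 0)).exists_bound_of_continuousOn
      (f := fun u : ℝ => NormedSpace.exp (u • D))
      fun u _ => (hasDerivAt_exp_smul_const (𝕂 := ℝ) D u).continuousAt.continuousWithinAt
    exact ⟨max F 1, by positivity, fun u hu => (hF u hu).trans (le_max_left _ _)⟩
  set C := (1 + B * H) * (L * ((n * ε + 2 / ρ) * (F * (2 * G + 1)))) + 1 with hC
  have hC0 : 0 < C := by positivity
  have step : ∀ k, ∀ e > 0, e ≤ 1 → (∀ t ≥ T k, η t ≤ e) →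
      ‖x (T (k + P))‖ ≤ ‖x (T k)‖ / 2 + C * e * (‖x (T k)‖ + 1) := by
    intro k e he he1 hηe
    have hT0 := h.T_nonneg' k
    have hlen := hTP k
    have hle : T k ≤ T (k + P) := h.T_mono (by omega)
    set s := T k with hs
    let U : ℝ → (X →L[ℝ] X) := fun t => NormedSpace.exp ((s - t) • D)
    have hU : ∀ t, HasDerivAt U (-(U t * D)) t := fun t => hasDerivAt_exp_sub_smul D s t
    set π := F * (e * (G * (‖x s‖ + e) + 1)) with hπ
    have hζ : RightDerivOn (fun t i => U t (x t i))
        (fun t i => ∑ j, a t i j • (U t (x t j) - U t (x t i)) + U t (p t i)) s (T (k + P)) := by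
      refine RightDerivOn.pi fun i => ?_
      refine ((RightDerivOn.of_hasDerivAt fun t _ => hU t).clm_apply
        (((hx (T (k + P))).mono hT0 le_rfl).apply i)).congr_deriv fun t _ => ?_
      have : (-(U t * D)) (x t i) = -(U t (D (x t i))) := rfl
      rw [this]
      simp only [map_add, map_sum, map_smul, map_sub]
      generalize ∑ j, a t i j • (U t (x t j) - U t (x t i)) = y
      abel
    have hUn : ∀ t ∈ Icc s (T (k + P)), ‖U t‖ ≤ F := fun t ht =>
      hF _ ⟨by linarith [ht.2], by linarith [ht.1]⟩
    have h1 := h.norm_le_contract_iterate (k := k) (π := π) (by positivity) L hζ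
      (fun t ht i => by
        refine ((U t).le_opNorm _).trans ?_
        have h2 := hUn t (Ico_subset_Icc_self ht)
        have h3 := hp t (hT0.trans ht.1) i
        have h4 := crude k e he he1 hηe t (Ico_subset_Icc_self ht)
        have h5 := hηe t ht.1
        rw [hπ]
        gcongr
        exact h3.trans (by gcongr))
      (fun t ht => by simp [hr t ht])
    have hUs : (fun i => U s (x s i)) = x s := by
      ext i; simp [U]
    rw [← hP, ← hn, ← hs, ← hκdef, hUs] at h1
    have hback : ‖x (T (k + P))‖ ≤ (1 + B * H) * ‖fun i => U (T (k + P)) (x (T (k + P)) i)‖ := by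
      refine (pi_norm_le_iff_of_nonneg (by positivity)).2 fun i => ?_
      have e1 : x (T (k + P)) i = NormedSpace.exp ((T (k + P) - s) • D)
          (U (T (k + P)) (x (T (k + P)) i)) := by
        have := exp_smul_mul_exp_smul D (T (k + P) - s) (s - T (k + P))
        rw [sub_add_sub_cancel, sub_self, zero_smul, NormedSpace.exp_zero] at this
        have := DFunLike.congr_fun this (x (T (k + P)) i)
        simpa [U] using this.symm
      rw [e1]
      refine (ContinuousLinearMap.le_opNorm _ _).trans ?_
      have h2 := hD (T (k + P) - s) (sub_nonneg.2 hle)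
      have h3 := norm_le_pi_norm (fun i => U (T (k + P)) (x (T (k + P)) i)) i
      have h4 : 1 + B * (T (k + P) - s) ≤ 1 + B * H := by gcongr
      exact mul_le_mul (h2.trans h4) h3 (norm_nonneg _) (by positivity)
    refine hback.trans ((mul_le_mul_of_nonneg_left h1 (by positivity)).trans ?_)
    have hπle : π ≤ F * (2 * G + 1) * (e * (‖x s‖ + 1)) := by
      rw [hπ, mul_assoc F]
      have : G * (‖x s‖ + e) + 1 ≤ (2 * G + 1) * (‖x s‖ + 1) := by
        nlinarith [norm_nonneg (x s), mul_le_mul_of_nonneg_left he1 hG0.le,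
          mul_nonneg hG0.le (norm_nonneg (x s))]
      calc F * (e * (G * (‖x s‖ + e) + 1)) ≤ F * (e * ((2 * G + 1) * (‖x s‖ + 1))) := by gcongr
        _ = _ := by ring
    have h6 : (1 + B * H) * (L * ((n * ε + 2 / ρ) * π)) ≤
        (1 + B * H) * (L * ((n * ε + 2 / ρ) * (F * (2 * G + 1) * (e * (‖x s‖ + 1))))) := by
      gcongr
    have h7 : (1 + B * H) * (κ ^ L * ‖x s‖) ≤ 1 / 2 * ‖x s‖ := by
      rw [← mul_assoc]
      exact mul_le_mul_of_nonneg_right hL (norm_nonneg _)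
    have h8 : 0 ≤ e * (‖x s‖ + 1) := by positivity
    have h9 : C * e * (‖x s‖ + 1) = (1 + B * H) *
        (L * ((n * ε + 2 / ρ) * (F * (2 * G + 1) * (e * (‖x s‖ + 1))))) + e * (‖x s‖ + 1) := by
      rw [hC]; ring
    rw [mul_add, h9, ← add_assoc]
    have h10 := add_le_add h7 h6
    refine h10.trans ((le_of_eq ?_).trans (le_add_of_nonneg_right h8))
    rw [one_div, ← div_eq_inv_mul]
  exact ⟨P, hPpos, G, hG0, C, hC0, fun k e he he1 hηe =>
    ⟨crude k e he he1 hηe, step k e he he1 hηe⟩⟩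

/-- A consensus system under joint connectivity, with root at zero, converges to zero also in
the presence of a drift `D` whose flow grows at most linearly, and of a perturbation of vanishing
relative size. -/
theorem tendsto_zero [CompleteSpace X] (h : JointlyRooted a r T ρ ε τ w) {D : X →L[ℝ] X} {B : ℝ}
    (hB : 0 ≤ B) (hD : ∀ t, 0 ≤ t → ‖NormedSpace.exp (t • D)‖ ≤ 1 + B * t) {x p : ℝ → V → X}
    (hx : ∀ b, RightDerivOn x
      (fun t i => D (x t i) + ∑ j, a t i j • (x t j - x t i) + p t i) 0 b)
    (hr : ∀ t, 0 ≤ t → x t r = 0) {η : ℝ → ℝ} (hη : Tendsto η atTop (𝓝 0))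
    (hp : ∀ t, 0 ≤ t → ∀ i, ‖p t i‖ ≤ η t * (‖x t‖ + 1)) :
    Tendsto x atTop (𝓝 0) := by
  obtain ⟨P, hPpos, G, hG0, C, hC0, hblock⟩ := h.exists_block_estimate hB hD hx hr hp
  have hev : ∀ e > 0, ∀ᶠ j : ℕ in atTop, ∀ t ≥ T (j * P), η t ≤ e := by
    intro e he
    obtain ⟨t₀, ht₀⟩ := eventually_atTop.1 (hη.eventually_le_const he)
    have : Tendsto (fun j : ℕ => T (j * P)) atTop atTop :=
      h.T_tendsto.comp (tendsto_id.atTop_mul_const' hPpos)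
    filter_upwards [this.eventually_ge_atTop t₀] with j hj t ht
    exact ht₀ t (hj.trans ht)
  have hW : Tendsto (fun j : ℕ => ‖x (T (j * P))‖) atTop (𝓝 0) :=
    tendsto_zero_of_le_half_add (fun _ => norm_nonneg _) hC0 fun e he he1 => by
      filter_upwards [hev e he] with j hj
      rw [add_mul, one_mul]
      exact (hblock _ e he he1 hj).2
  have hTP' : Tendsto (fun j : ℕ => T (j * P)) atTop atTop :=
    h.T_tendsto.comp (tendsto_id.atTop_mul_const' hPpos)
  refine tendsto_zero_iff_norm_tendsto_zero.2 (Metric.tendsto_atTop.2 fun δ hδ => ?_)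
  obtain ⟨e, he, he1, heδ⟩ : ∃ e : ℝ, 0 < e ∧ e ≤ 1 ∧ G * (2 * e) < δ := by
    refine ⟨min 1 (δ / (4 * G)), by positivity, min_le_left _ _, ?_⟩
    have : min 1 (δ / (4 * G)) ≤ δ / (4 * G) := min_le_right _ _
    calc G * (2 * _) ≤ G * (2 * (δ / (4 * G))) := by gcongr
      _ = δ / 2 := by field_simp; norm_num
      _ < δ := half_lt_self hδ
  obtain ⟨J, hJ⟩ := eventually_atTop.1 ((hev e he).and (hW.eventually_le_const he))
  refine ⟨T (J * P), fun t ht => ?_⟩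
  obtain ⟨j, hj, hjt⟩ := exists_mem_Ico_of_tendsto_atTop hTP' (k := J) ht
  obtain ⟨h1, h2⟩ := hJ j hj
  have h3 := (hblock (j * P) e he he1 h1).1 t ⟨hjt.1, by
    have := hjt.2.le
    rwa [add_mul, one_mul] at this⟩
  rw [dist_zero_right, norm_norm]
  calc ‖x t‖ ≤ G * (‖x (T (j * P))‖ + e) := h3
    _ ≤ G * (2 * e) := by gcongr; linarith
    _ < δ := heδ

end JointlyRooted

/-! ### The switching network and the leader -/

namespace SwitchingSignal

variable {P : Type} (σ : SwitchingSignal P)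

theorem t_lt_succ (k : ℕ) : σ.t k < σ.t (k + 1) := by linarith [σ.dwell k, σ.τ₀_pos]

theorem t_mono : Monotone σ.t := monotone_nat_of_le_succ fun k => (σ.t_lt_succ k).le

theorem t_nonneg (k : ℕ) : 0 ≤ σ.t k := σ.t_zero ▸ σ.t_mono k.zero_le

theorem mul_le_t (k : ℕ) : k * σ.τ₀ ≤ σ.t k := by
  induction k with
  | zero => simp [σ.t_zero]
  | succ k ih => push_cast; linarith [σ.dwell k]

theorem t_tendsto : Tendsto σ.t atTop atTop :=
  tendsto_atTop_mono σ.mul_le_t (tendsto_natCast_atTop_atTop.atTop_mul_const σ.τ₀_pos)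

theorem exists_mem_Ico {t : ℝ} (ht : 0 ≤ t) : ∃ k, t ∈ Ico (σ.t k) (σ.t (k + 1)) := by
  obtain ⟨k, -, hk⟩ := exists_mem_Ico_of_tendsto_atTop σ.t_tendsto (k := 0) (t := t)
    (by rwa [σ.t_zero])
  exact ⟨k, hk⟩

end SwitchingSignal

/-- A path that leaves a set has an edge that leaves it. -/
theorem Relation.ReflTransGen.exists_exit {V : Type*} {r : V → V → Prop} {R : Set V} {u v : V}
    (h : Relation.ReflTransGen r u v) (hu : u ∈ R) (hv : v ∉ R) : ∃ x ∈ R, ∃ y ∉ R, r x y := by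
  induction h with
  | refl => exact absurd hu hv
  | @tail b c _ hbc ih =>
    by_cases hb : b ∈ R
    · exact ⟨b, hb, c, hv, hbc⟩
    · exact ih hb

/-- The weights of the consensus dynamics with gain `μ`: those of the network, except that the
leader, node `0`, listens to nobody. -/
noncomputable def followerWeights {N : ℕ} (A : Matrix (Fin (N + 1)) (Fin (N + 1)) ℝ) (μ : ℝ)
    (i j : Fin (N + 1)) : ℝ :=
  if i = 0 then 0 else μ * A i j

/-- In a jointly connected switching network the consensus weights meet the quantitative form of
joint connectivity: an edge that leaves a set during a window has, until the next switching instant,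
one of finitely many positive weights. -/
theorem JointlyConnected.exists_jointlyRooted {N n₀ : ℕ} {σ : SwitchingSignal (Fin n₀)}
    {Γ : Fin n₀ → Digraph (Fin (N + 1))} (hconn : JointlyConnected σ Γ)
    {A : Fin n₀ → Matrix (Fin (N + 1)) (Fin (N + 1)) ℝ} (hA : ∀ k, IsWeightedAdjacency (A k) (Γ k))
    {μ : ℝ} (hμ : 0 < μ) :
    ∃ T ρ ε τ w, JointlyRooted (fun t => followerWeights (A (σ.σ t)) μ) 0 T ρ ε τ w := by
  obtain ⟨ι, hι, ε, hε, hconn⟩ := hconn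
  obtain ⟨w, hw, hwA⟩ : ∃ w : ℝ, 0 < w ∧ ∀ k i j, 0 < A k i j → w ≤ μ * A k i j := by
    have : ∀ z : Fin n₀ × Fin (N + 1) × Fin (N + 1), ∃ w : ℝ, 0 < w ∧
        (0 < A z.1 z.2.1 z.2.2 → w ≤ μ * A z.1 z.2.1 z.2.2) := fun z => by
      by_cases h : 0 < A z.1 z.2.1 z.2.2
      · exact ⟨_, mul_pos hμ h, fun _ => le_rfl⟩
      · exact ⟨1, one_pos, fun h' => absurd h' h⟩
    choose f hf hfA using this
    have hne : (Finset.univ : Finset (Fin n₀ × Fin (N + 1) × Fin (N + 1))).Nonempty :=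
      ⟨(σ.σ 0, 0, 0), Finset.mem_univ _⟩
    refine ⟨Finset.univ.inf' hne f, (Finset.lt_inf'_iff _).2 fun z _ => hf z, fun k i j h => ?_⟩
    exact (Finset.inf'_le f (Finset.mem_univ (k, i, j))).trans (hfA (k, i, j) h)
  obtain ⟨ρ, hρ⟩ : ∃ ρ : ℝ, ∀ k i, ∑ j, μ * A k i j ≤ ρ := by
    refine ⟨∑ k, ∑ i, ∑ j, μ * A k i j, fun k i => ?_⟩
    have h0 : ∀ k i, 0 ≤ ∑ j, μ * A k i j :=
      fun k i => Finset.sum_nonneg fun j _ => mul_nonneg hμ.le ((hA k).1 i j)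
    exact (Finset.single_le_sum (f := fun i => ∑ j, μ * A k i j) (fun i _ => h0 k i)
      (Finset.mem_univ i)).trans (Finset.single_le_sum (f := fun k => ∑ i, ∑ j, μ * A k i j)
        (fun k _ => Finset.sum_nonneg fun i _ => h0 k i) (Finset.mem_univ k))
  -- `JointlyRooted` asks for `2 * w ≤ ρ`, hence the maximum.
  refine ⟨fun k => σ.t (ι k), max ρ (2 * w), ε, σ.τ₀, w, ?_, ?_, hw, le_max_right _ _, σ.τ₀_pos,
    σ.t_nonneg _, fun k => ?_, fun k => by linarith [(hconn k).1],
    σ.t_tendsto.comp hι.tendsto_atTop, ?_⟩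
  · intro t i j
    dsimp only [followerWeights]
    split_ifs
    · exact le_rfl
    · exact mul_nonneg hμ.le ((hA _).1 i j)
  · intro t i
    by_cases hi : i = 0
    · simp [followerWeights, hi, hw.le]
    · simpa [followerWeights, hi] using Or.inl (hρ (σ.σ t) i)
  · exact (σ.t_lt_succ _).trans_le (σ.t_mono (hι (Nat.lt_succ_self k)))
  · intro k R h0 hR
    obtain ⟨v, hv⟩ := (ne_univ_iff_exists_notMem R).1 hR
    obtain ⟨i, rfl⟩ := Fin.exists_succ_eq.2 (fun h : v = 0 => hv (h ▸ h0))
    obtain ⟨x, hx, y, hy, hxy⟩ := ((hconn k).2 i).exists_exit h0 hv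
    obtain ⟨⟨l, hl⟩, hxy⟩ := Digraph.iSup_adj.1 hxy
    refine ⟨y, hy, x, hx, σ.t l, σ.t_mono hl.1, ?_, fun t ht => ?_⟩
    · have : σ.t (l + 1) ≤ σ.t (ι (k + 1)) := σ.t_mono hl.2
      linarith [σ.dwell l]
    · dsimp only [followerWeights]
      rw [if_neg (show y ≠ 0 from fun h => hy (h ▸ h0)),
        σ.const l t ⟨ht.1, by linarith [ht.2, σ.dwell l]⟩]
      exact hwA _ _ _ (((hA _).2.2 y x).2 hxy)

section Leader

variable {E F : Type} [NormedAddCommGroup E] [InnerProductSpace ℝ E]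
  [NormedAddCommGroup F] [InnerProductSpace ℝ F] [FiniteDimensional ℝ F]
  {C : F →L[ℝ] E} {S : F →L[ℝ] F}

theorem isLeaderTrajectory_exp (S : F →L[ℝ] F) (x : F) :
    IsLeaderTrajectory S fun t => NormedSpace.exp (t • S) x := fun t _ => by
  have : CompleteSpace F := FiniteDimensional.complete ℝ F
  exact ((hasDerivAt_exp_smul_const' (𝕂 := ℝ) S t).clm_apply
    (hasDerivAt_const t x)).hasDerivWithinAt.congr_deriv (by simp)

theorem IsLeaderTrajectory.eq_exp {v : ℝ → F} (hv : IsLeaderTrajectory S v) {t : ℝ} (ht : 0 ≤ t) :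
    v t = NormedSpace.exp (t • S) (v 0) := by
  have : CompleteSpace F := FiniteDimensional.complete ℝ F
  -- Uniqueness: `e^{-uS} v(u)` is constant.
  have h1 : RightDerivOn (fun u => NormedSpace.exp ((0 - u) • S) (v u)) (fun _ => 0) 0 t := by
    refine ((RightDerivOn.of_hasDerivAt fun u _ => hasDerivAt_exp_sub_smul S 0 u).clm_apply
      (RightDerivOn.of_hasDerivWithinAt (f := v) fun u hu =>
        (hv u hu.1).mono Icc_subset_Ici_self)).congr_deriv fun u _ => ?_
    exact neg_add_cancel _
  have h2 := h1.norm_sub_le (c := 0) (fun _ _ => by simp) (right_mem_Icc.2 ht)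
  rw [zero_mul, norm_le_zero_iff, sub_eq_zero] at h2
  have h3 := exp_smul_mul_exp_smul S t (0 - t)
  rw [zero_sub, add_neg_cancel, zero_smul, NormedSpace.exp_zero] at h3
  have h4 := DFunLike.congr_fun h3 (v t)
  simp only [sub_zero, zero_sub, zero_smul, NormedSpace.exp_zero] at h2
  have h5 : NormedSpace.exp (t • S) (NormedSpace.exp ((-t) • S) (v t)) = v t := h4
  rw [h2] at h5
  exact h5.symm

/-- By observability a bound on the leader's velocity `C S v` bounds `S v`, and it does so uniformly
on the unit ball of initial values. -/
theorem IsObservable.exists_norm_mul_exp_le (hobs : IsObservable C S)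
    (hleader : LeaderVelocityBounded C S) :
    ∃ B, 0 ≤ B ∧ ∀ t : ℝ, 0 ≤ t → ‖S * NormedSpace.exp (t • S)‖ ≤ B := by
  have : CompleteSpace F := FiniteDimensional.complete ℝ F
  let O : F →ₗ[ℝ] Fin (Module.finrank ℝ F) → E :=
    LinearMap.pi fun k => ((C ∘L (S ^ (k : ℕ)) : F →L[ℝ] E) : F →ₗ[ℝ] E)
  have hO : LinearMap.ker O = ⊥ := LinearMap.ker_eq_bot'.2 fun x hx =>
    hobs x fun k hk => congrFun hx ⟨k, hk⟩
  -- `S e^{tS} x` is recovered from `C Sᵏ (S e^{tS} x) = C S e^{tS} (Sᵏ x)`, the leader's velocities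
  -- for the initial values `Sᵏ x`.
  obtain ⟨c, -, hc⟩ := O.exists_antilipschitzWith hO
  have hpt : ∀ x, ∃ B, ∀ t : Ici (0 : ℝ), ‖(S * NormedSpace.exp ((t : ℝ) • S)) x‖ ≤ B := by
    intro x
    choose b hb using fun k : ℕ =>
      hleader _ (isLeaderTrajectory_exp S ((S ^ k) x))
    refine ⟨c * ∑ k : Fin (Module.finrank ℝ F), |b k|, fun t => ?_⟩
    refine (ZeroHomClass.bound_of_antilipschitz O hc _).trans ?_
    gcongr
    refine (pi_norm_le_iff_of_nonneg (by positivity)).2 fun k => ?_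
    refine le_trans ?_ (Finset.single_le_sum (f := fun k : Fin (Module.finrank ℝ F) => |b k|)
      (fun i _ => abs_nonneg _) (Finset.mem_univ k))
    refine le_trans (le_of_eq ?_) ((hb k t t.2).trans (le_abs_self _))
    have hcomm : Commute (S ^ (k : ℕ)) (NormedSpace.exp ((t : ℝ) • S)) :=
      (((Commute.refl S).pow_left k).smul_right (t : ℝ)).exp_right
    have h1 : S ^ (k : ℕ) * (S * NormedSpace.exp ((t : ℝ) • S)) =
        S * (NormedSpace.exp ((t : ℝ) • S) * S ^ (k : ℕ)) := by
      rw [← hcomm.eq, ← mul_assoc, ← mul_assoc, ← pow_succ, ← pow_succ']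
    exact congrArg (fun y => ‖C y‖) (DFunLike.congr_fun h1 x)
  obtain ⟨B, hB⟩ := banach_steinhaus hpt
  exact ⟨B, (norm_nonneg _).trans (hB ⟨0, mem_Ici.2 le_rfl⟩), fun t ht => hB ⟨t, ht⟩⟩

/-- The flow of `S` grows at most linearly when its derivative `S e^{tS}` is bounded. -/
theorem norm_exp_le_of_norm_mul_exp_le {B : ℝ}
    (hB : ∀ t : ℝ, 0 ≤ t → ‖S * NormedSpace.exp (t • S)‖ ≤ B) {t : ℝ} (ht : 0 ≤ t) :
    ‖NormedSpace.exp (t • S)‖ ≤ 1 + B * t := by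
  have : CompleteSpace F := FiniteDimensional.complete ℝ F
  have h1 : RightDerivOn (fun t : ℝ => NormedSpace.exp (t • S))
      (fun t => S * NormedSpace.exp (t • S)) 0 t :=
    RightDerivOn.of_hasDerivAt fun u _ => hasDerivAt_exp_smul_const' (𝕂 := ℝ) S u
  have h2 := h1.norm_sub_le (fun u hu => hB u hu.1) (right_mem_Icc.2 ht)
  rw [sub_zero, zero_smul, NormedSpace.exp_zero] at h2
  have h3 : ‖(1 : F →L[ℝ] F)‖ ≤ 1 := ContinuousLinearMap.norm_id_le
  linarith [norm_le_norm_add_norm_sub' (NormedSpace.exp (t • S)) (1 : F →L[ℝ] F)]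

end Leader

/-! ### Barbalat's lemma and stable filters -/

section Calculus

variable {X : Type*} [NormedAddCommGroup X] [NormedSpace ℝ X]

namespace RightDerivOn

theorem inner {E : Type*} [NormedAddCommGroup E] [InnerProductSpace ℝ E] {f f' g g' : ℝ → E}
    {a b : ℝ} (hf : RightDerivOn f f' a b) (hg : RightDerivOn g g' a b) :
    RightDerivOn (fun t => (inner ℝ (f t) (g t) : ℝ))
      (fun t => inner ℝ (f t) (g' t) + inner ℝ (f' t) (g t)) a b :=
  ⟨hf.cont.inner hg.cont, fun t ht => (hf.deriv t ht).inner ℝ (hg.deriv t ht)⟩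

theorem fderiv_comp {Y : Type*} [NormedAddCommGroup Y] [NormedSpace ℝ Y] {M : X → Y}
    (hM : ContDiff ℝ 1 M) {f f' : ℝ → X} {a b : ℝ} (hf : RightDerivOn f f' a b) :
    RightDerivOn (fun t => M (f t)) (fun t => fderiv ℝ M (f t) (f' t)) a b :=
  ⟨hM.continuous.comp_continuousOn hf.cont, fun t ht =>
    ((hM.differentiable one_ne_zero (f t)).hasFDerivAt).comp_hasDerivWithinAt t (hf.deriv t ht)⟩

theorem le_add {f f' : ℝ → ℝ} {a b c : ℝ} (h : RightDerivOn f f' a b)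
    (hc : ∀ t ∈ Ico a b, f' t ≤ c) {t : ℝ} (ht : t ∈ Icc a b) : f t ≤ f a + c * (t - a) :=
  image_le_of_deriv_right_le_deriv_boundary h.cont h.deriv (B := fun t => f a + c * (t - a))
    (B' := fun _ => c) (by simp) (by fun_prop)
    (fun t _ => by simpa using
      ((((hasDerivAt_id t).sub_const a).const_mul c).const_add (f a)).hasDerivWithinAt) hc ht

theorem congr {f f' g : ℝ → X} {a b : ℝ} (h : RightDerivOn f f' a b)
    (hg : ∀ t ∈ Icc a b, g t = f t) : RightDerivOn g f' a b :=
  ⟨h.cont.congr hg, fun t ht => (h.deriv t ht).congr_of_eventuallyEq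
    (mem_of_superset (Icc_mem_nhdsGE ht.2) fun u hu => hg u ⟨ht.1.trans hu.1, hu.2⟩)
    (hg t (Ico_subset_Icc_self ht))⟩

theorem unique {f f' g' : ℝ → X} {a b : ℝ} (h : RightDerivOn f f' a b) (h' : RightDerivOn f g' a b)
    {t : ℝ} (ht : t ∈ Ico a b) : f' t = g' t :=
  (uniqueDiffWithinAt_Ici t).eq_deriv _ (h.deriv t ht) (h'.deriv t ht)

end RightDerivOn

theorem PiecewiseDeriv.rightDerivOn {P : Type} {X : Type} [NormedAddCommGroup X] [NormedSpace ℝ X]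
    {σ : SwitchingSignal P} {f f' : ℝ → X}
    (h : PiecewiseDeriv σ f f') (b : ℝ) : RightDerivOn f f' 0 b :=
  ⟨h.1.mono Icc_subset_Ici_self, fun t ht => by
    obtain ⟨k, hk⟩ := σ.exists_mem_Ico ht.1
    exact (h.2 k t hk).mono_of_mem_nhdsWithin
      (mem_of_superset (Ico_mem_nhdsGE hk.2) (Ico_subset_Ico_left hk.1))⟩

end Calculus

section EventuallyBounded

variable {X : Type*} [NormedAddCommGroup X]

/-- `f` is bounded near infinity. -/
def EventuallyBounded (f : ℝ → X) : Prop := ∃ B, ∀ᶠ t in atTop, ‖f t‖ ≤ B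

namespace EventuallyBounded

variable {Y : Type*} [NormedAddCommGroup Y] {f g : ℝ → X}

theorem of_tendsto {c : X} (h : Tendsto f atTop (𝓝 c)) : EventuallyBounded f :=
  ⟨‖c‖ + 1, h.norm.eventually_le_const (by linarith)⟩

theorem add (hf : EventuallyBounded f) (hg : EventuallyBounded g) :
    EventuallyBounded fun t => f t + g t := by
  obtain ⟨B, hB⟩ := hf
  obtain ⟨B', hB'⟩ := hg
  refine ⟨B + B', ?_⟩
  filter_upwards [hB, hB'] with t h h'
  exact (norm_add_le _ _).trans (add_le_add h h')

theorem neg (hf : EventuallyBounded f) : EventuallyBounded fun t => -f t := by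
  obtain ⟨B, hB⟩ := hf
  exact ⟨B, by simpa using hB⟩

theorem sub (hf : EventuallyBounded f) (hg : EventuallyBounded g) :
    EventuallyBounded fun t => f t - g t := by
  simpa [sub_eq_add_neg] using hf.add hg.neg

/-- A bound that is positive, and valid from some nonnegative time on. -/
theorem exists_bound (hf : EventuallyBounded f) :
    ∃ B > 0, ∃ t₀ ≥ 0, ∀ t ≥ t₀, ‖f t‖ ≤ B := by
  obtain ⟨B, hB⟩ := hf
  obtain ⟨t₀, h⟩ := eventually_atTop.1 hB
  exact ⟨max B 1, by positivity, max t₀ 0, le_max_right _ _,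
    fun t ht => (h t ((le_max_left _ _).trans ht)).trans (le_max_left _ _)⟩

variable [NormedSpace ℝ X] [NormedSpace ℝ Y]

theorem clm_apply {A : ℝ → X →L[ℝ] Y} (hA : EventuallyBounded A) (hf : EventuallyBounded f) :
    EventuallyBounded fun t => A t (f t) := by
  obtain ⟨B, hB⟩ := hA
  obtain ⟨B', hB'⟩ := hf
  refine ⟨B * B', ?_⟩
  filter_upwards [hB, hB'] with t h h'
  exact ((A t).le_opNorm _).trans (mul_le_mul h h' (norm_nonneg _) ((norm_nonneg _).trans h))

theorem clm (L : X →L[ℝ] Y) (hf : EventuallyBounded f) : EventuallyBounded fun t => L (f t) :=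
  (EventuallyBounded.of_tendsto (tendsto_const_nhds (x := L))).clm_apply hf

theorem const_smul (c : ℝ) (hf : EventuallyBounded f) : EventuallyBounded fun t => c • f t :=
  hf.clm (c • ContinuousLinearMap.id ℝ X)

theorem clm_apply_tendsto {A : ℝ → X →L[ℝ] Y} (hA : EventuallyBounded A)
    (hf : Tendsto f atTop (𝓝 0)) : Tendsto (fun t => A t (f t)) atTop (𝓝 0) := by
  obtain ⟨B, hB⟩ := hA
  refine squeeze_zero_norm' (a := fun t => B * ‖f t‖) ?_ (by simpa using hf.norm.const_mul B)
  filter_upwards [hB] with t h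
  exact ((A t).le_opNorm _).trans (by gcongr)

end EventuallyBounded

variable [NormedSpace ℝ X]

/-- A stable first order filter maps bounded signals to bounded signals. -/
theorem EventuallyBounded.of_relaxation {f f' : ℝ → X} (h : ∀ b, RightDerivOn f f' 0 b) {α : ℝ}
    (hα : 0 < α) (hb : EventuallyBounded fun t => f' t + α • f t) : EventuallyBounded f := by
  obtain ⟨B, hB0, t₀, ht₀, hB⟩ := hb.exists_bound
  refine ⟨‖f t₀‖ + B / α, eventually_atTop.2 ⟨t₀, fun t ht => ?_⟩⟩
  have h1 := ((h t).mono ht₀ le_rfl).norm_le_of_relaxation (ρ := α) (β := B / α)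
    (fun u hu => by rw [mul_div_cancel₀ _ hα.ne']; exact hB u hu.1) (right_mem_Icc.2 ht)
  have h2 : Real.exp (-(α * (t - t₀))) ≤ 1 :=
    Real.exp_le_one_iff.2 (by have := mul_nonneg hα.le (sub_nonneg.2 ht); linarith)
  have h3 := Real.exp_pos (-(α * (t - t₀)))
  have h4 : 0 < B / α := by positivity
  nlinarith [norm_nonneg (f t₀)]

/-- A stable first order filter maps vanishing signals to vanishing signals. -/
theorem tendsto_zero_of_relaxation {f f' : ℝ → X} (h : ∀ b, RightDerivOn f f' 0 b) {α : ℝ}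
    (hα : 0 < α) (hb : Tendsto (fun t => f' t + α • f t) atTop (𝓝 0)) :
    Tendsto f atTop (𝓝 0) := by
  refine tendsto_zero_iff_norm_tendsto_zero.2 (Metric.tendsto_atTop.2 fun ε hε => ?_)
  have hb' := (tendsto_zero_iff_norm_tendsto_zero.1 hb).eventually_le_const
    (show 0 < α * (ε / 2) by positivity)
  obtain ⟨t₁, ht₁⟩ := eventually_atTop.1 hb'
  set t₀ := max t₁ 0
  have h5 : Tendsto (fun t => Real.exp (-(α * (t - t₀))) * ‖f t₀‖) atTop (𝓝 0) := by
    have : Tendsto (fun t => α * (t - t₀)) atTop atTop :=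
      (tendsto_atTop_add_const_right _ _ tendsto_id).const_mul_atTop hα
    simpa using (Real.tendsto_exp_neg_atTop_nhds_zero.comp this).mul_const ‖f t₀‖
  obtain ⟨t₂, ht₂⟩ := eventually_atTop.1 (h5.eventually_lt_const (half_pos hε))
  refine ⟨max t₀ t₂, fun t ht => ?_⟩
  have ht0 : t₀ ≤ t := (le_max_left _ _).trans ht
  have h1 := ((h t).mono (le_max_right t₁ 0) le_rfl).norm_le_of_relaxation (ρ := α) (β := ε / 2)
    (fun u hu => ht₁ u ((le_max_left _ _).trans hu.1)) (right_mem_Icc.2 ht0)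
  have h3 := Real.exp_pos (-(α * (t - t₀)))
  have h4 := ht₂ t ((le_max_right _ _).trans ht)
  rw [dist_zero_right, norm_norm]
  nlinarith

/-- A form of Barbalat's lemma: a Lipschitz signal `s` that a nonnegative function `V` dissipates
with rate at least `k ‖s‖²` vanishes at infinity. -/
theorem tendsto_zero_of_dissipation {V V' : ℝ → ℝ} {s s' : ℝ → X}
    (hV : ∀ b, RightDerivOn V V' 0 b)
    (hV0 : ∀ t, 0 ≤ t → 0 ≤ V t) {k : ℝ} (hk : 0 < k)
    (hV' : ∀ t, 0 ≤ t → V' t ≤ -(k * ‖s t‖ ^ 2)) (hs : ∀ b, RightDerivOn s s' 0 b)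
    (hs' : EventuallyBounded s') : Tendsto s atTop (𝓝 0) := by
  obtain ⟨l, hl, t₀, ht₀, hs'⟩ := hs'.exists_bound
  have hanti : Antitone fun t => V (max t t₀) := fun t u htu => by
    have := ((hV (max u t₀)).mono (ht₀.trans (le_max_right t t₀)) le_rfl).le_add (c := 0)
      (fun x hx => (hV' x ((ht₀.trans (le_max_right t t₀)).trans hx.1)).trans
        (by simp only [Left.neg_nonpos_iff]; positivity))
      (right_mem_Icc.2 (max_le_max_right t₀ htu))
    simpa using this
  have hbdd : BddBelow (range fun t => V (max t t₀)) :=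
    ⟨0, by rintro _ ⟨t, rfl⟩; exact hV0 _ (ht₀.trans (le_max_right _ _))⟩
  have hlim := tendsto_atTop_ciInf hanti hbdd
  refine tendsto_zero_iff_norm_tendsto_zero.2 (Metric.tendsto_atTop.2 fun ε hε => ?_)
  set h := ε / (2 * l) with hh
  have hh0 : 0 < h := by positivity
  have hdiff := hlim.sub (hlim.comp (tendsto_atTop_add_const_right atTop h tendsto_id))
  rw [sub_self] at hdiff
  obtain ⟨t₁, ht₁⟩ := eventually_atTop.1
    (hdiff.eventually_lt_const (show 0 < k * (ε / 2) ^ 2 * h by positivity))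
  refine ⟨max t₀ t₁, fun t ht => ?_⟩
  have h0 : t₀ ≤ t := (le_max_left _ _).trans ht
  have h1 := ht₁ t ((le_max_right _ _).trans ht)
  simp only [Function.comp, id, max_eq_left h0, max_eq_left (h0.trans (by linarith : t ≤ t + h))]
    at h1
  rw [dist_zero_right, norm_norm]
  by_contra! hcon
  have h2 := ((hV (t + h)).mono (ht₀.trans h0) le_rfl).le_add (c := -(k * (ε / 2) ^ 2))
    (fun u hu => (hV' u (by linarith [hu.1])).trans (by
      have h3 := ((hs (t + h)).mono (ht₀.trans h0) le_rfl).norm_sub_le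
        (fun x hx => hs' x (h0.trans hx.1)) (Ico_subset_Icc_self hu)
      have h4 : l * (u - t) ≤ ε / 2 := by
        calc l * (u - t) ≤ l * h := by gcongr; linarith [hu.2]
          _ = ε / 2 := by rw [hh]; field_simp
      have h5 : ε / 2 ≤ ‖s u‖ := by
        linarith [norm_le_norm_add_norm_sub (s u) (s t)]
      gcongr)) (right_mem_Icc.2 (by linarith))
  linarith

end EventuallyBounded

theorem norm_exp_smul_zero_le {X : Type*} [NormedAddCommGroup X] [NormedSpace ℝ X] (t : ℝ) :
    ‖NormedSpace.exp (t • (0 : X →L[ℝ] X))‖ ≤ 1 := by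
  rw [smul_zero, NormedSpace.exp_zero]
  exact ContinuousLinearMap.norm_id_le

/-- Finite combinations with bounded coefficients of vanishing signals vanish. -/
theorem tendsto_sum_smul_zero {V X : Type*} [Fintype V] [NormedAddCommGroup X] [NormedSpace ℝ X]
    {a : ℝ → V → ℝ} {c : ℝ} (ha : ∀ t j, |a t j| ≤ c) {y : ℝ → V → X}
    (hy : ∀ j, Tendsto (fun t => y t j) atTop (𝓝 0)) :
    Tendsto (fun t => ∑ j, a t j • y t j) atTop (𝓝 0) := by
  have : Tendsto (fun t => ∑ j, c * ‖y t j‖) atTop (𝓝 0) := by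
    simpa using tendsto_finsetSum Finset.univ fun j _ => (hy j).norm.const_mul c
  refine squeeze_zero_norm (fun t => (norm_sum_le _ _).trans (Finset.sum_le_sum fun j _ => ?_)) this
  rw [norm_smul, Real.norm_eq_abs]
  exact mul_le_mul_of_nonneg_right (ha t j) (norm_nonneg _)

/-! ### Positive definite matrices -/

section PosDef

variable {E : Type} [NormedAddCommGroup E] [InnerProductSpace ℝ E] [CompleteSpace E]
  {A : E →L[ℝ] E}

theorem IsPosDef.exists_coercive [FiniteDimensional ℝ E] (hA : IsPosDef A) :
    ∃ k > 0, ∀ x, k * ‖x‖ ^ 2 ≤ inner ℝ x (A x) := by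
  rcases subsingleton_or_nontrivial E with hE | hE
  · exact ⟨1, one_pos, fun x => by simp [Subsingleton.elim x 0]⟩
  · obtain ⟨x₀, hx₀, hmin⟩ := (isCompact_sphere (0 : E) 1).exists_isMinOn
      (NormedSpace.sphere_nonempty.2 zero_le_one) (f := fun x => (inner ℝ x (A x) : ℝ))
      (by fun_prop)
    have hx₀' : x₀ ≠ 0 := by
      rintro rfl
      simp at hx₀
    refine ⟨_, hA.2 x₀ hx₀', fun x => ?_⟩
    rcases eq_or_ne x 0 with rfl | hx
    · simp
    · have hn : 0 < ‖x‖ := norm_pos_iff.2 hx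
      have h1 : (inner ℝ x₀ (A x₀) : ℝ) ≤ inner ℝ (‖x‖⁻¹ • x) (A (‖x‖⁻¹ • x)) :=
        hmin (by simp [norm_smul, hn.ne'])
      rw [map_smul, inner_smul_left, inner_smul_right] at h1
      simp only [conj_trivial] at h1
      calc (inner ℝ x₀ (A x₀) : ℝ) * ‖x‖ ^ 2
          ≤ (‖x‖⁻¹ * (‖x‖⁻¹ * inner ℝ x (A x))) * ‖x‖ ^ 2 := by gcongr
        _ = inner ℝ x (A x) := by field_simp

theorem IsPosDef.isInvertible [FiniteDimensional ℝ E] (hA : IsPosDef A) : A.IsInvertible := by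
  have hinj : Function.Injective A := (injective_iff_map_eq_zero A).2 fun x hx => by
    by_contra h
    simpa [hx] using hA.2 x h
  exact ⟨(LinearEquiv.ofInjectiveEndo (A : E →ₗ[ℝ] E) hinj).toContinuousLinearEquiv, by ext; rfl⟩

theorem IsPosDef.apply_inverse [FiniteDimensional ℝ E] (hA : IsPosDef A) (x : E) :
    A (A.inverse x) = x := by
  obtain ⟨e, rfl⟩ := hA.isInvertible
  simp

end PosDef

/-! ### The closed loop: Lyapunov function, observers and tracking -/

/-- A trajectory of the closed loop on `[a, b]`, in terms of right derivatives, for time varying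
weights `A t`. -/
structure IsLoopOn {N : ℕ}
    {E : Type} [NormedAddCommGroup E] [InnerProductSpace ℝ E] [CompleteSpace E]
    {F : Type} [NormedAddCommGroup F] [InnerProductSpace ℝ F] [CompleteSpace F]
    {Q : Type} [NormedAddCommGroup Q] [InnerProductSpace ℝ Q] [CompleteSpace Q]
    (sys : Fin N → ELSystem E Q) (S : F →L[ℝ] F) (law : AdaptiveLaw N E F Q)
    (A : ℝ → Matrix (Fin (N + 1)) (Fin (N + 1)) ℝ) (x : ℝ → NetState N E F Q) (a b : ℝ) :
    Prop where
  leader_S : ∀ t ∈ Icc a b, (x t).S 0 = S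
  leader_v : RightDerivOn (fun t => (x t).η 0) (fun t => S ((x t).η 0)) a b
  position : ∀ i, RightDerivOn (fun t => (x t).q i) (fun t => (x t).w i) a b
  velocity : ∀ i, ∃ acc : ℝ → E, RightDerivOn (fun t => (x t).w i) acc a b ∧ ∀ t ∈ Ico a b,
      (sys i).M ((x t).q i) (acc t) + (sys i).Cor ((x t).q i) ((x t).w i) ((x t).w i) +
        (sys i).G ((x t).q i) = law.torque (A t) (x t) i
  estimate : ∀ i, RightDerivOn (fun t => (x t).Θ i) (fun t => law.ΘDot (A t) (x t) i) a b
  observer_S : ∀ i : Fin N, RightDerivOn (fun t => (x t).S i.succ)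
    (fun t => law.SDot (A t) (x t) i) a b
  observer_η : ∀ i : Fin N, RightDerivOn (fun t => (x t).η i.succ)
    (fun t => law.ηDot (A t) (x t) i) a b

section Loop

variable {N n₀ : ℕ}
  {E : Type} [NormedAddCommGroup E] [InnerProductSpace ℝ E] [CompleteSpace E]
  {F : Type} [NormedAddCommGroup F] [InnerProductSpace ℝ F] [CompleteSpace F]
  {Q : Type} [NormedAddCommGroup Q] [InnerProductSpace ℝ Q] [CompleteSpace Q]
  {sys : Fin N → ELSystem E Q} {S : F →L[ℝ] F} {law : AdaptiveLaw N E F Q}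

theorem IsClosedLoop.isLoopOn {σ : SwitchingSignal (Fin n₀)}
    {A : Fin n₀ → Matrix (Fin (N + 1)) (Fin (N + 1)) ℝ} {x : ℝ → NetState N E F Q}
    (h : IsClosedLoop sys S law σ A x) (b : ℝ) :
    IsLoopOn sys S law (fun t => A (σ.σ t)) x 0 b where
  leader_S t ht := h.leader_S t ht.1
  leader_v := .of_hasDerivWithinAt (f := fun t => (x t).η 0)
    fun t ht => (h.leader_v t ht.1).mono Icc_subset_Ici_self
  position i := .of_hasDerivWithinAt fun t ht => (h.position i t ht.1).mono Icc_subset_Ici_self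
  velocity i := by
    obtain ⟨acc, h1, h2⟩ := h.velocity i
    exact ⟨acc, h1.rightDerivOn b, fun t ht => h2 t ht.1⟩
  estimate i := (h.estimate i).rightDerivOn b
  observer_S i := (h.observer_S i).rightDerivOn b
  observer_η i := (h.observer_η i).rightDerivOn b

/-- Half the energy `⟨s, M s⟩` of the velocity error, plus half the squared parameter error in the
metric given by `Λ`. -/
noncomputable def lyapunov (sys : Fin N → ELSystem E Q) (law : AdaptiveLaw N E F Q)
    (x : NetState N E F Q) (i : Fin N) : ℝ :=
  (inner ℝ (law.s x i) ((sys i).M (x.q i) (law.s x i)) +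
    inner ℝ (x.Θ i - (sys i).Θ) (law.Λ i (x.Θ i - (sys i).Θ))) / 2

namespace IsLoopOn

variable {A : ℝ → Matrix (Fin (N + 1)) (Fin (N + 1)) ℝ} {x : ℝ → NetState N E F Q} {a b : ℝ}

theorem refVel (h : IsLoopOn sys S law A x a b) (i : Fin N) :
    RightDerivOn (fun t => law.refVel (x t) i) (fun t => law.refAcc (A t) (x t) i) a b :=
  (((h.observer_S i).clm_apply (h.observer_η i)).clm law.C).sub
    (((h.position i).sub ((h.observer_η i).clm law.C)).const_smul law.α)

/-- The velocity error `s` obeys `M ṡ + Cor s = -K s + Y Θ̃`, where `Θ̃` is the parameter error. -/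
theorem error (h : IsLoopOn sys S law A x a b) (hY : ∀ i, law.Y i = (sys i).Y) (i : Fin N) :
    ∃ sd : ℝ → E, RightDerivOn (fun t => law.s (x t) i) sd a b ∧ ∀ t ∈ Ico a b,
      (sys i).M ((x t).q i) (sd t) = -(law.K i (law.s (x t) i)) +
        law.regr (A t) (x t) i ((x t).Θ i - (sys i).Θ) -
        (sys i).Cor ((x t).q i) ((x t).w i) (law.s (x t) i) := by
  obtain ⟨acc, h1, h2⟩ := h.velocity i
  refine ⟨_, h1.sub (h.refVel i), fun t ht => ?_⟩
  have h3 := h2 t ht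
  have h4 := (sys i).regressor ((x t).q i) ((x t).w i) (law.refAcc (A t) (x t) i)
    (law.refVel (x t) i)
  have h5 : law.regr (A t) (x t) i = (sys i).Y ((x t).q i) ((x t).w i)
    (law.refAcc (A t) (x t) i) (law.refVel (x t) i) := by rw [AdaptiveLaw.regr, hY]
  rw [← h5] at h4
  have h6 : (sys i).Cor ((x t).q i) ((x t).w i) (law.s (x t) i) =
    (sys i).Cor ((x t).q i) ((x t).w i) ((x t).w i) -
      (sys i).Cor ((x t).q i) ((x t).w i) (law.refVel (x t) i) := map_sub _ _ _
  rw [AdaptiveLaw.torque] at h3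
  have h7 : (sys i).M ((x t).q i) (acc t) = -(law.K i (law.s (x t) i)) +
      law.regr (A t) (x t) i ((x t).Θ i) - (sys i).G ((x t).q i) -
      (sys i).Cor ((x t).q i) ((x t).w i) ((x t).w i) := by
    rw [← h3]; abel
  rw [map_sub, map_sub, h6, ← h4, h7]
  abel

/-- Along the closed loop the Lyapunov function has the derivative `-⟨s, K s⟩`: the Coriolis term
cancels the derivative of the inertia matrix, and the adaptation law cancels the parameter error. -/
theorem lyapunov_deriv (h : IsLoopOn sys S law A x a b) (hY : ∀ i, law.Y i = (sys i).Y) {i : Fin N}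
    (hΛ : IsSelfAdjoint (law.Λ i)) (hΛ' : ∀ y, law.Λ i ((law.Λ i).inverse y) = y) :
    RightDerivOn (fun t => lyapunov sys law (x t) i)
      (fun t => -inner ℝ (law.s (x t) i) (law.K i (law.s (x t) i))) a b := by
  obtain ⟨sd, h1, h2⟩ := h.error hY i
  have hΘ : RightDerivOn (fun t => (x t).Θ i - (sys i).Θ) (fun t => law.ΘDot (A t) (x t) i) a b :=
    ((h.estimate i).sub (.of_hasDerivAt fun t _ => hasDerivAt_const t (sys i).Θ)).congr_deriv
      fun t _ => sub_zero _
  have hM := RightDerivOn.fderiv_comp (sys i).contDiff_M (h.position i)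
  have hV := ((h1.inner (hM.clm_apply h1)).add (hΘ.inner (hΘ.clm (law.Λ i)))).const_smul (1 / 2 : ℝ)
  have e : (fun t => lyapunov sys law (x t) i) = fun t => (1 / 2 : ℝ) •
      ((inner ℝ (law.s (x t) i) ((sys i).M ((x t).q i) (law.s (x t) i)) : ℝ) +
        inner ℝ ((x t).Θ i - (sys i).Θ) (law.Λ i ((x t).Θ i - (sys i).Θ))) := by
    funext t
    simp only [lyapunov, smul_eq_mul]
    ring
  rw [e]
  refine hV.congr_deriv fun t ht => ?_
  have hs : ∀ y z, (inner ℝ ((sys i).M ((x t).q i) y) z : ℝ) =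
      inner ℝ y ((sys i).M ((x t).q i) z) := fun y z =>
    (ContinuousLinearMap.isSelfAdjoint_iff_isSymmetric.1
      ((sys i).isPosDef_M ((x t).q i)).1) y z
  have hl : ∀ y z, (inner ℝ (law.Λ i y) z : ℝ) = inner ℝ y (law.Λ i z) := fun y z =>
    (ContinuousLinearMap.isSelfAdjoint_iff_isSymmetric.1 hΛ) y z
  have hskew : (inner ℝ (law.s (x t) i) (fderiv ℝ (sys i).M ((x t).q i) ((x t).w i)
      (law.s (x t) i)) : ℝ) = 2 * inner ℝ (law.s (x t) i)
        ((sys i).Cor ((x t).q i) ((x t).w i) (law.s (x t) i)) := by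
    have h3 := congrArg (fun B : E →L[ℝ] E => (inner ℝ (law.s (x t) i) (B (law.s (x t) i)) : ℝ))
      ((sys i).skew ((x t).q i) ((x t).w i))
    simp only [ContinuousLinearMap.adjoint_inner_right] at h3
    rw [real_inner_comm, neg_apply, inner_neg_right, sub_apply, smul_apply, inner_sub_right,
      inner_smul_right] at h3
    linarith
  have hΘd : law.Λ i (law.ΘDot (A t) (x t) i) =
      -(ContinuousLinearMap.adjoint (law.regr (A t) (x t) i) (law.s (x t) i)) := by
    rw [AdaptiveLaw.ΘDot, map_neg, hΛ']
  have h4 : (inner ℝ (law.ΘDot (A t) (x t) i) (law.Λ i ((x t).Θ i - (sys i).Θ)) : ℝ) =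
      inner ℝ ((x t).Θ i - (sys i).Θ) (law.Λ i (law.ΘDot (A t) (x t) i)) := by
    rw [← hl, real_inner_comm]
  have h5 : (inner ℝ (sd t) ((sys i).M ((x t).q i) (law.s (x t) i)) : ℝ) =
      inner ℝ (law.s (x t) i) ((sys i).M ((x t).q i) (sd t)) := by
    rw [← hs, real_inner_comm]
  have h6 : (inner ℝ ((x t).Θ i - (sys i).Θ) (ContinuousLinearMap.adjoint
      (law.regr (A t) (x t) i) (law.s (x t) i)) : ℝ) =
      inner ℝ (law.s (x t) i) (law.regr (A t) (x t) i ((x t).Θ i - (sys i).Θ)) := by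
    rw [ContinuousLinearMap.adjoint_inner_right, real_inner_comm]
  simp only [inner_add_right, h4, h5, hΘd, hskew, h2 t ht, inner_sub_right, inner_neg_right, h6,
    smul_eq_mul]
  ring

theorem norm_error_le (h : IsLoopOn sys S law A x a b) (hY : ∀ i, law.Y i = (sys i).Y) {i : Fin N}
    (hΛ : IsSelfAdjoint (law.Λ i)) (hΛ' : ∀ y, law.Λ i ((law.Λ i).inverse y) = y)
    (hK : ∀ y, 0 ≤ inner ℝ y (law.K i y)) {km kl : ℝ} (hkm : 0 < km) (hkl : 0 < kl)
    (hM : ∀ q y, km * ‖y‖ ^ 2 ≤ inner ℝ y ((sys i).M q y))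
    (hl : ∀ y, kl * ‖y‖ ^ 2 ≤ inner ℝ y (law.Λ i y)) {t : ℝ} (ht : t ∈ Icc a b) :
    ‖law.s (x t) i‖ ≤ √(2 * lyapunov sys law (x a) i / km) ∧
      ‖(x t).Θ i - (sys i).Θ‖ ≤ √(2 * lyapunov sys law (x a) i / kl) := by
  have h1 := (h.lyapunov_deriv hY hΛ hΛ').le_add (c := 0)
    (fun t _ => neg_nonpos.2 (hK _)) ht
  rw [zero_mul, add_zero] at h1
  have h2 := hM ((x t).q i) (law.s (x t) i)
  have h3 := hl ((x t).Θ i - (sys i).Θ)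
  have h4 : 0 ≤ km * ‖law.s (x t) i‖ ^ 2 := by positivity
  have h5 : 0 ≤ kl * ‖(x t).Θ i - (sys i).Θ‖ ^ 2 := by positivity
  have h6 : lyapunov sys law (x t) i = (inner ℝ (law.s (x t) i)
    ((sys i).M ((x t).q i) (law.s (x t) i)) +
    inner ℝ ((x t).Θ i - (sys i).Θ) (law.Λ i ((x t).Θ i - (sys i).Θ))) / 2 := rfl
  constructor
  · refine Real.le_sqrt_of_sq_le ((le_div_iff₀ hkm).2 ?_)
    linarith
  · refine Real.le_sqrt_of_sq_le ((le_div_iff₀ hkl).2 ?_)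
    linarith

theorem observer_S' (h : IsLoopOn sys S law A x a b) (i : Fin (N + 1)) :
    RightDerivOn (fun t => (x t).S i)
      (fun t => ∑ j, followerWeights (A t) law.μ₁ i j • ((x t).S j - (x t).S i)) a b := by
  cases i using Fin.cases with
  | zero =>
    exact ((RightDerivOn.of_hasDerivAt fun t _ => hasDerivAt_const t S).congr
      h.leader_S).congr_deriv fun t _ => by simp [followerWeights]
  | succ i =>
    exact (h.observer_S i).congr_deriv fun t _ => by
      simp [AdaptiveLaw.SDot, followerWeights, Finset.smul_sum, smul_smul]

theorem observer_η' (h : IsLoopOn sys S law A x a b) (i : Fin (N + 1)) :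
    RightDerivOn (fun t => (x t).η i) (fun t => (x t).S i ((x t).η i) +
      ∑ j, followerWeights (A t) law.μ₂ i j • ((x t).η j - (x t).η i)) a b := by
  cases i using Fin.cases with
  | zero =>
    exact h.leader_v.congr_deriv fun t ht => by
      simp [followerWeights, h.leader_S t (Ico_subset_Icc_self ht)]
  | succ i =>
    exact (h.observer_η i).congr_deriv fun t _ => by
      simp [AdaptiveLaw.ηDot, followerWeights, Finset.smul_sum, smul_smul]

/-- The observer error of the leader's matrix obeys the consensus dynamics, and decays even after
multiplication by `1 + t`. -/
theorem tendsto_observer_S (h : ∀ b, IsLoopOn sys S law A x 0 b) {T : ℕ → ℝ} {ρ ε τ w : ℝ}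
    (hT : JointlyRooted (fun t => followerWeights (A t) law.μ₁) 0 T ρ ε τ w) :
    Tendsto (fun t i => (1 + t) • ((x t).S i - S)) atTop (𝓝 0) := by
  refine hT.tendsto_zero (D := 0) (B := 0) le_rfl (fun t _ => ?_) (p := fun t i => (x t).S i - S)
    (fun b => RightDerivOn.pi fun i => ?_) (fun t ht => ?_) (η := fun t => 1 / (1 + t)) ?_
    (fun t ht i => ?_)
  · simpa using norm_exp_smul_zero_le (X := F →L[ℝ] F) t
  · refine ((RightDerivOn.of_hasDerivAt (f := fun t => 1 + t) (f' := fun _ => 1) fun t _ => by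
      simpa using (hasDerivAt_id t).const_add 1).smul (((h b).observer_S' i).sub
        (.of_hasDerivAt fun t _ => hasDerivAt_const t S))).congr_deriv fun t _ => ?_
    simp only [zero_apply, zero_add, sub_zero, one_smul, Finset.smul_sum, ← smul_sub]
    congr 1
    refine Finset.sum_congr rfl fun j _ => ?_
    rw [smul_comm, sub_sub_sub_cancel_right]
  · simp [(h t).leader_S t ⟨ht, le_rfl⟩]
  · simp only [one_div]
    exact (tendsto_atTop_add_const_left _ (1 : ℝ) tendsto_id).inv_tendsto_atTop
  · have h1 := norm_le_pi_norm (fun i => (1 + t) • ((x t).S i - S)) i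
    have h0 : 0 < 1 + t := by linarith
    simp only [norm_smul, Real.norm_eq_abs, abs_of_pos h0] at h1
    rw [one_div, le_inv_mul_iff₀ h0]
    linarith

/-- The observer error of the leader's state obeys the consensus dynamics with drift `S` and
perturbation `(Sᵢ - S) ηᵢ`. As `ηᵢ` is the error plus the leader's state, which grows at most
linearly, the decay of `(1 + t) (Sᵢ - S)` makes the perturbation relatively small. -/
theorem tendsto_observer_η (h : ∀ b, IsLoopOn sys S law A x 0 b) {T : ℕ → ℝ} {ρ ε τ w : ℝ}
    (hT : JointlyRooted (fun t => followerWeights (A t) law.μ₂) 0 T ρ ε τ w)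
    (hS : Tendsto (fun t i => (1 + t) • ((x t).S i - S)) atTop (𝓝 0)) {B : ℝ} (hB : 0 ≤ B)
    (hexp : ∀ t : ℝ, 0 ≤ t → ‖NormedSpace.exp (t • S)‖ ≤ 1 + B * t)
    (hv : ∀ t : ℝ, 0 ≤ t → (x t).η 0 = NormedSpace.exp (t • S) ((x 0).η 0)) :
    Tendsto (fun t i => (x t).η i - (x t).η 0) atTop (𝓝 0) := by
  set c := 1 + (1 + B) * ‖(x 0).η 0‖ with hc
  refine hT.tendsto_zero (D := S) hB hexp (p := fun t i => ((x t).S i - S) ((x t).η i))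
    (fun b => RightDerivOn.pi fun i => ?_) (fun t ht => sub_self _)
    (η := fun t => ‖fun i => (1 + t) • ((x t).S i - S)‖ * c) ?_ (fun t ht i => ?_)
  · refine (((h b).observer_η' i).sub (h b).leader_v).congr_deriv fun t _ => ?_
    simp only [sub_sub_sub_cancel_right, sub_apply, map_sub]
    abel
  · simpa using hS.norm.mul_const c
  · have h1 := norm_le_pi_norm (fun i => (1 + t) • ((x t).S i - S)) i
    have h0 : 0 < 1 + t := by linarith
    simp only [norm_smul, Real.norm_eq_abs, abs_of_pos h0] at h1
    set y := ‖fun i => (1 + t) • ((x t).S i - S)‖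
    have hy : 0 ≤ y := norm_nonneg _
    have h2 := norm_le_pi_norm (fun i => (x t).η i - (x t).η 0) i
    set z := ‖fun i => (x t).η i - (x t).η 0‖
    have hz : 0 ≤ z := norm_nonneg _
    have h3 : ‖(x t).η i‖ ≤ z + (1 + B * t) * ‖(x 0).η 0‖ := by
      have h4 : ‖(x t).η 0‖ ≤ (1 + B * t) * ‖(x 0).η 0‖ := by
        rw [hv t ht]
        exact (ContinuousLinearMap.le_opNorm _ _).trans (by gcongr; exact hexp t ht)
      linarith [norm_le_norm_add_norm_sub' ((x t).η i) ((x t).η 0)]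
    refine (ContinuousLinearMap.le_opNorm _ _).trans ?_
    have h5 : z + (1 + B * t) * ‖(x 0).η 0‖ ≤ (1 + t) * (c * (z + 1)) := by
      have h6 : (1 + B * t) ≤ (1 + t) * (1 + B) := by nlinarith
      have h7 : (1 + B * t) * ‖(x 0).η 0‖ ≤ (1 + t) * ((1 + B) * ‖(x 0).η 0‖) := by
        rw [← mul_assoc]; gcongr
      have h8 : z ≤ (1 + t) * z := by nlinarith
      have h9 : 0 ≤ (1 + t) * ((1 + B) * ‖(x 0).η 0‖ * z + 1) := by positivity
      rw [hc]
      linarith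
    calc ‖(x t).S i - S‖ * ‖(x t).η i‖ ≤ ‖(x t).S i - S‖ * ((1 + t) * (c * (z + 1))) := by
          gcongr; exact h3.trans h5
      _ = ((1 + t) * ‖(x t).S i - S‖) * (c * (z + 1)) := by ring
      _ ≤ y * (c * (z + 1)) := by gcongr
      _ = y * c * (z + 1) := by ring

/-- Convergence of the observers implies tracking. -/
theorem tendsto_of_observer (h : ∀ b, IsLoopOn sys S law A x 0 b)
    (hS : Tendsto (fun t i => (1 + t) • ((x t).S i - S)) atTop (𝓝 0))
    (hη : Tendsto (fun t i => (x t).η i - (x t).η 0) atTop (𝓝 0))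
    {c : ℝ} (hv : ∀ t : ℝ, 0 ≤ t → ‖(x t).η 0‖ ≤ c * (1 + t))
    (hSv : EventuallyBounded fun t => S ((x t).η 0))
    {cA : ℝ} (hA : ∀ t i j, |A t i j| ≤ cA)
    (hα : 0 < law.α) (hY : ∀ i, law.Y i = (sys i).Y) {i : Fin N}
    (hreg : RegressorBounded (sys i))
    (hΛ : IsSelfAdjoint (law.Λ i)) (hΛ' : ∀ y, law.Λ i ((law.Λ i).inverse y) = y)
    {kl : ℝ} (hkl : 0 < kl) (hl : ∀ y, kl * ‖y‖ ^ 2 ≤ inner ℝ y (law.Λ i y))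
    {kK : ℝ} (hkK : 0 < kK) (hK : ∀ y, kK * ‖y‖ ^ 2 ≤ inner ℝ y (law.K i y))
    {km : ℝ} (hkm : 0 < km) (hM : ∀ q y, km * ‖y‖ ^ 2 ≤ inner ℝ y ((sys i).M q y))
    {kc : ℝ} (hCor : ∀ q w, ‖(sys i).Cor q w‖ ≤ kc * ‖w‖) :
    Tendsto (fun t => (x t).q i - law.C ((x t).η 0)) atTop (𝓝 0) ∧
    Tendsto (fun t => (x t).w i - law.C (S ((x t).η 0))) atTop (𝓝 0) := by
  -- the observers
  have hS1 : ∀ j, Tendsto (fun t => (1 + t) • ((x t).S j - S)) atTop (𝓝 0) :=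
    fun j => tendsto_pi_nhds.1 hS j
  have hS0 : ∀ j, Tendsto (fun t => (x t).S j - S) atTop (𝓝 0) := fun j => by
    refine squeeze_zero_norm' ?_ (tendsto_zero_iff_norm_tendsto_zero.1 (hS1 j))
    filter_upwards [eventually_ge_atTop 0] with t ht
    rw [norm_smul, Real.norm_eq_abs, abs_of_pos (by linarith)]
    nlinarith [norm_nonneg ((x t).S j - S)]
  have hη0 : ∀ j, Tendsto (fun t => (x t).η j - (x t).η 0) atTop (𝓝 0) :=
    fun j => tendsto_pi_nhds.1 hη j
  have hvb : EventuallyBounded fun t => (1 + t)⁻¹ • (x t).η 0 := by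
    refine ⟨c, ?_⟩
    filter_upwards [eventually_ge_atTop 0] with t ht
    have h0 : 0 < 1 + t := by linarith
    rw [norm_smul, norm_inv, Real.norm_eq_abs, abs_of_pos h0, inv_mul_le_iff₀ h0, mul_comm]
    exact hv t ht
  have hSη : ∀ j k, Tendsto (fun t => ((x t).S j - S) ((x t).η k)) atTop (𝓝 0) := fun j k => by
    have h1 := (EventuallyBounded.of_tendsto (hS0 j)).clm_apply_tendsto (hη0 k)
    have h2 : Tendsto (fun t => ((1 + t) • ((x t).S j - S)) ((1 + t)⁻¹ • (x t).η 0)) atTop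
        (𝓝 0) := by
      obtain ⟨B, hB⟩ := hvb
      refine squeeze_zero_norm' (a := fun t => ‖(1 + t) • ((x t).S j - S)‖ * B) ?_
        (by simpa using (hS1 j).norm.mul_const B)
      filter_upwards [hB] with t ht
      exact (ContinuousLinearMap.le_opNorm _ _).trans (by gcongr)
    have h3 := h1.add h2
    rw [add_zero] at h3
    refine h3.congr' ?_
    filter_upwards [eventually_ge_atTop 0] with t ht
    have h0 : (1 + t) ≠ 0 := by linarith
    rw [smul_apply, map_smul, smul_inv_smul₀ h0, map_sub, sub_add_cancel]
  have hout : Tendsto (fun t => (x t).S i.succ ((x t).η i.succ) - S ((x t).η 0)) atTop (𝓝 0) := by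
    have h1 := (hSη i.succ i.succ).add
      ((S.continuous.tendsto' 0 0 (map_zero S)).comp (hη0 i.succ))
    rw [add_zero] at h1
    refine h1.congr fun t => ?_
    simp only [Function.comp, sub_apply, map_sub]
    abel
  have hSDot : Tendsto (fun t => law.SDot (A t) (x t) i ((x t).η i.succ)) atTop (𝓝 0) := by
    have h1 := (tendsto_sum_smul_zero (y := fun t j => ((x t).S j - (x t).S i.succ)
      ((x t).η i.succ)) (fun t j => hA t i.succ j) (fun j => by
        simpa using (hSη j i.succ).sub (hSη i.succ i.succ))).const_smul law.μ₁
    rw [smul_zero] at h1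
    refine h1.congr fun t => ?_
    simp [AdaptiveLaw.SDot, sum_apply, smul_apply]
  have hcons : Tendsto (fun t => law.μ₂ • ∑ j, A t i.succ j • ((x t).η j - (x t).η i.succ)) atTop
      (𝓝 0) := by
    have h1 := (tendsto_sum_smul_zero (y := fun t j => (x t).η j - (x t).η i.succ)
      (fun t j => hA t i.succ j) (fun j => by
        simpa using (hη0 j).sub (hη0 i.succ))).const_smul law.μ₂
    rwa [smul_zero] at h1
  have hSb : EventuallyBounded fun t => (x t).S i.succ := by
    simpa using (EventuallyBounded.of_tendsto (hS0 i.succ)).add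
      (EventuallyBounded.of_tendsto (tendsto_const_nhds (x := S)))
  have hSηb : EventuallyBounded fun t => (x t).S i.succ ((x t).η i.succ) := by
    simpa using (EventuallyBounded.of_tendsto hout).add hSv
  have hηDot : EventuallyBounded fun t => law.ηDot (A t) (x t) i :=
    hSηb.add (EventuallyBounded.of_tendsto hcons)
  -- boundedness of the closed loop
  have herr := fun t (ht : 0 ≤ t) => (h t).norm_error_le hY hΛ hΛ'
    (fun y => (by positivity : 0 ≤ kK * ‖y‖ ^ 2).trans (hK y)) hkm hkl hM hl ⟨ht, le_rfl⟩
  have hsb : EventuallyBounded fun t => law.s (x t) i :=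
    ⟨_, eventually_atTop.2 ⟨0, fun t ht => (herr t ht).1⟩⟩
  have hΘb : EventuallyBounded fun t => (x t).Θ i - (sys i).Θ :=
    ⟨_, eventually_atTop.2 ⟨0, fun t ht => (herr t ht).2⟩⟩
  have hfilter : ∀ b, RightDerivOn (fun t => (x t).q i - law.C ((x t).η i.succ))
      (fun t => (x t).w i - law.C (law.ηDot (A t) (x t) i)) 0 b := fun b =>
    ((h b).position i).sub (((h b).observer_η i).clm law.C)
  have hfilter_eq : ∀ t, (x t).w i - law.C (law.ηDot (A t) (x t) i) +
      law.α • ((x t).q i - law.C ((x t).η i.succ)) = law.s (x t) i -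
        law.C (law.μ₂ • ∑ j, A t i.succ j • ((x t).η j - (x t).η i.succ)) := fun t => by
    simp only [AdaptiveLaw.ηDot, AdaptiveLaw.s, AdaptiveLaw.refVel, map_add]
    abel
  have hCcons := (law.C.continuous.tendsto' 0 0 (map_zero law.C)).comp hcons
  have heb : EventuallyBounded fun t => (x t).q i - law.C ((x t).η i.succ) :=
    .of_relaxation hfilter hα (by
      simp only [hfilter_eq]
      exact hsb.sub (.of_tendsto hCcons))
  have hrefVel : EventuallyBounded fun t => law.refVel (x t) i :=
    (hSηb.clm law.C).sub (heb.const_smul law.α)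
  have hw : EventuallyBounded fun t => (x t).w i := by
    simpa [AdaptiveLaw.s] using hsb.add hrefVel
  have hrefAcc : EventuallyBounded fun t => law.refAcc (A t) (x t) i :=
    (((EventuallyBounded.of_tendsto hSDot).add (hSb.clm_apply hηDot)).clm law.C).sub
      ((hw.sub (hηDot.clm law.C)).const_smul law.α)
  have hregr : EventuallyBounded fun t => law.regr (A t) (x t) i := by
    obtain ⟨R₁, h₁⟩ := hw
    obtain ⟨R₂, h₂⟩ := hrefAcc
    obtain ⟨R₃, h₃⟩ := hrefVel
    obtain ⟨B, hB⟩ := hreg (max R₁ (max R₂ R₃))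
    refine ⟨B, ?_⟩
    filter_upwards [h₁, h₂, h₃] with t h₁ h₂ h₃
    rw [AdaptiveLaw.regr, hY]
    exact hB _ _ _ _ (h₁.trans (le_max_left _ _))
      (h₂.trans ((le_max_left _ _).trans (le_max_right _ _)))
      (h₃.trans ((le_max_right _ _).trans (le_max_right _ _)))
  have hCorb : EventuallyBounded fun t => (sys i).Cor ((x t).q i) ((x t).w i) := by
    obtain ⟨B, hB0, t₀, ht₀, hB⟩ := hw.exists_bound
    refine ⟨|kc| * B, eventually_atTop.2 ⟨t₀, fun t ht => (hCor _ _).trans ?_⟩⟩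
    calc kc * ‖(x t).w i‖ ≤ |kc| * ‖(x t).w i‖ := by gcongr; exact le_abs_self kc
      _ ≤ _ := by gcongr; exact hB t ht
  -- the velocity error vanishes
  choose! sd hsd using fun b => (h b).error hY i
  have hsd_eq : ∀ b, 0 ≤ b → ∀ t ∈ Ico 0 b, sd b t = sd (t + 1) t := fun b hb t ht =>
    ((hsd b).1.mono le_rfl (min_le_left b (t + 1))).unique
      ((hsd (t + 1)).1.mono le_rfl (min_le_right b (t + 1))) ⟨ht.1, lt_min ht.2 (by linarith)⟩
  have hs' : ∀ b, RightDerivOn (fun t => law.s (x t) i) (fun t => sd (t + 1) t) 0 b := fun b =>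
    (hsd b).1.congr_deriv fun t ht => hsd_eq b (ht.1.trans ht.2.le) t ht
  have hsdb : EventuallyBounded fun t => sd (t + 1) t := by
    obtain ⟨B, hB⟩ := (((hsb.clm (law.K i)).neg.add (hregr.clm_apply hΘb)).sub
      (hCorb.clm_apply hsb))
    refine ⟨B / km, ?_⟩
    filter_upwards [hB, eventually_ge_atTop 0] with t hBt ht
    rw [← (hsd (t + 1)).2 t ⟨ht, by linarith⟩] at hBt
    rw [le_div_iff₀ hkm]
    have h1 := hM ((x t).q i) (sd (t + 1) t)
    have h2 := real_inner_le_norm (sd (t + 1) t) ((sys i).M ((x t).q i) (sd (t + 1) t))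
    rcases (norm_nonneg (sd (t + 1) t)).eq_or_lt with h0 | h0
    · rw [← h0, zero_mul]
      exact (norm_nonneg _).trans hBt
    · refine le_trans (le_of_mul_le_mul_left ?_ h0) hBt
      linarith
  have hs : Tendsto (fun t => law.s (x t) i) atTop (𝓝 0) :=
    tendsto_zero_of_dissipation (V := fun t => lyapunov sys law (x t) i)
      (fun b => (h b).lyapunov_deriv hY hΛ hΛ')
      (fun t _ => by
        have h1 := hM ((x t).q i) (law.s (x t) i)
        have h2 := hl ((x t).Θ i - (sys i).Θ)
        have h3 : 0 ≤ km * ‖law.s (x t) i‖ ^ 2 := by positivity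
        have h4 : 0 ≤ kl * ‖(x t).Θ i - (sys i).Θ‖ ^ 2 := by positivity
        unfold lyapunov
        linarith)
      hkK (fun t _ => neg_le_neg (hK _)) hs' hsdb
  have he : Tendsto (fun t => (x t).q i - law.C ((x t).η i.succ)) atTop (𝓝 0) :=
    tendsto_zero_of_relaxation hfilter hα (by
      simp only [hfilter_eq]
      simpa using hs.sub hCcons)
  constructor
  · have h1 := he.add ((law.C.continuous.tendsto' 0 0 (map_zero law.C)).comp (hη0 i.succ))
    rw [add_zero] at h1
    refine h1.congr fun t => ?_
    simp only [Function.comp, map_sub]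
    abel
  · have h1 := (hs.add ((law.C.continuous.tendsto' 0 0 (map_zero law.C)).comp hout)).sub
      (he.const_smul law.α)
    rw [add_zero, smul_zero, sub_zero] at h1
    refine h1.congr fun t => ?_
    simp only [Function.comp, map_sub, AdaptiveLaw.s, AdaptiveLaw.refVel]
    abel

end IsLoopOn

end Loop

/-! ### Ordinary differential equations with an a priori bound -/

section Ode

variable {X : Type*} [NormedAddCommGroup X] [NormedSpace ℝ X] [FiniteDimensional ℝ X]

/-- A locally Lipschitz autonomous equation has solutions on `[a, b]` as soon as there is an a
priori bound for solutions on the subintervals `[a, c]`. The field is cut off outside of a large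
ball; a solution of the resulting bounded equation never leaves that ball. -/
theorem exists_solution_of_apriori_bound {f : X → X} (hf : LocallyLipschitz f) {a b : ℝ}
    (hab : a ≤ b) (x₀ : X) {R : ℝ}
    (hR : ∀ c ∈ Icc a b, ∀ x : ℝ → X, x a = x₀ →
      (∀ t ∈ Icc a c, HasDerivWithinAt x (f (x t)) (Icc a c) t) → ‖x c‖ ≤ R) :
    ∃ x : ℝ → X, x a = x₀ ∧ ∀ t ∈ Icc a b, HasDerivWithinAt x (f (x t)) (Icc a b) t := by
  have : CompleteSpace X := FiniteDimensional.complete ℝ X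
  -- the cut-off is `1` on the ball of radius `R + 1` and `0` outside of the ball of radius `R + 2`
  let φ : X → ℝ := fun x => max 0 (min 1 (R + 2 - ‖x‖))
  have hφ : LocallyLipschitz φ := by
    have h1 : LocallyLipschitz fun x : X => R + 2 - ‖x‖ :=
      ((LipschitzWith.const (R + 2)).sub lipschitzWith_one_norm).locallyLipschitz
    exact (h1.const_min 1).const_max 0
  have hφ0 : ∀ x, 0 ≤ φ x := fun x => le_max_left _ _
  have hφ1 : ∀ x, φ x ≤ 1 := fun x => max_le zero_le_one (min_le_left _ _)
  have hφin : ∀ x, ‖x‖ ≤ R + 1 → φ x = 1 := fun x hx => by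
    simp only [φ]
    rw [min_eq_left (by linarith), max_eq_right zero_le_one]
  have hφout : ∀ x, R + 2 ≤ ‖x‖ → φ x = 0 := fun x hx =>
    max_eq_left ((min_le_right _ _).trans (by linarith))
  let g : X → X := fun x => φ x • f x
  have hg : LocallyLipschitz g :=
    (contDiff_smul (𝕜 := ℝ) (F := X) (n := 1)).locallyLipschitz.comp (hφ.prodMk hf)
  obtain ⟨L, hL0, hL⟩ : ∃ L : ℝ, 0 ≤ L ∧ ∀ x, ‖g x‖ ≤ L := by
    obtain ⟨L, hL⟩ := (isCompact_closedBall (0 : X) (R + 2)).exists_bound_of_continuousOn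
      hg.continuous.continuousOn
    refine ⟨max L 0, le_max_right _ _, fun x => ?_⟩
    by_cases hx : ‖x‖ ≤ R + 2
    · exact (hL x (by simpa using hx)).trans (le_max_left _ _)
    · simp [g, hφout x (not_le.1 hx).le]
  obtain ⟨K, hK⟩ := (hg.locallyLipschitzOn (s := Metric.closedBall x₀
    (L * (b - a)))).exists_lipschitzOnWith_of_compact (isCompact_closedBall _ _)
  have hPL : IsPicardLindelof (fun _ => g) (tmin := a) (tmax := b) ⟨a, left_mem_Icc.2 hab⟩ x₀
      (Real.toNNReal (L * (b - a))) 0 (Real.toNNReal L) K := by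
    have h0 : 0 ≤ L * (b - a) := mul_nonneg hL0 (sub_nonneg.2 hab)
    refine ⟨fun t _ => ?_, fun x _ => continuousOn_const, fun t _ x _ => ?_, ?_⟩
    · rwa [Real.coe_toNNReal _ h0]
    · rw [Real.coe_toNNReal _ hL0]
      exact hL x
    · rw [Real.coe_toNNReal _ h0, Real.coe_toNNReal _ hL0]
      simp [hab]
  obtain ⟨x, hx0, hx⟩ := hPL.exists_eq_forall_mem_Icc_hasDerivWithinAt₀
  have hxa : x a = x₀ := hx0
  have hcont : ContinuousOn x (Icc a b) := fun t ht => (hx t ht).continuousWithinAt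
  -- as long as the solution is in the inner ball it solves the original equation
  have hgood : ∀ c ∈ Icc a b, (∀ t ∈ Icc a c, ‖x t‖ ≤ R + 1) → ‖x c‖ ≤ R := by
    intro c hc h
    refine hR c hc x hxa fun t ht => ?_
    have := (hx t ⟨ht.1, ht.2.trans hc.2⟩).mono (Icc_subset_Icc_right hc.2)
    simpa [g, hφin _ (h t ht)] using this
  have hall : ∀ t ∈ Icc a b, ‖x t‖ ≤ R + 1 := by
    refine IsClosed.Icc_subset_of_forall_mem_nhdsGT_of_Icc_subset
      (s := {t | ‖x t‖ ≤ R + 1}) ?_ ?_ fun t ht hsub => ?_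
    · rw [inter_comm]
      exact hcont.norm.preimage_isClosed_of_isClosed isClosed_Icc isClosed_Iic
    · have := hR a ⟨le_rfl, hab⟩ x hxa fun t ht => by
        rw [Icc_self] at ht ⊢
        rw [mem_singleton_iff.1 ht]
        exact HasFDerivWithinAt.of_subsingleton subsingleton_singleton
      exact this.trans (by linarith)
    · have h1 := hgood t (Ico_subset_Icc_self ht) hsub
      have h2 : ∀ᶠ u in 𝓝[Icc a b] t, ‖x u‖ < R + 1 :=
        (hcont t (Ico_subset_Icc_self ht)).norm.eventually_lt_const (by linarith)
      have h3 : 𝓝[>] t ≤ 𝓝[Icc a b] t := by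
        rw [← nhdsWithin_Ioc_eq_nhdsGT ht.2]
        exact nhdsWithin_mono _ fun u hu => ⟨ht.1.trans hu.1.le, hu.2⟩
      exact mem_of_superset (h3 h2) fun u hu => le_of_lt (show ‖x u‖ < R + 1 from hu)
  refine ⟨x, hxa, fun t ht => ?_⟩
  simpa [g, hφin _ (hall t ht)] using hx t ht

/-- Solutions on consecutive intervals are glued to a solution on the half line. -/
theorem exists_glued_solution {X : Type*} [NormedAddCommGroup X] [NormedSpace ℝ X] {T : ℕ → ℝ}
    (hT : ∀ k, T k < T (k + 1)) (hT' : Tendsto T atTop atTop) {f : ℕ → X → X}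
    (hf : ∀ k x₀, ∃ x : ℝ → X, x (T k) = x₀ ∧ ∀ t ∈ Icc (T k) (T (k + 1)),
      HasDerivWithinAt x (f k (x t)) (Icc (T k) (T (k + 1))) t) (x₀ : X) :
    ∃ x : ℝ → X, x (T 0) = x₀ ∧ ∀ k, ∀ t ∈ Icc (T k) (T (k + 1)),
      HasDerivWithinAt x (f k (x t)) (Icc (T k) (T (k + 1))) t := by
  classical
  choose φ hφ0 hφ using hf
  let y : ℕ → X := fun k => Nat.rec x₀ (fun k y => φ k y (T (k + 1))) k
  have hy : ∀ k, y (k + 1) = φ k (y k) (T (k + 1)) := fun k => rfl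
  have hmono : StrictMono T := strictMono_nat_of_lt_succ hT
  let idx : ℝ → ℕ := fun t => if h : T 0 ≤ t then (exists_mem_Ico_of_tendsto_atTop hT' h).choose
    else 0
  have hidx : ∀ k, ∀ t ∈ Ico (T k) (T (k + 1)), idx t = k := by
    intro k t ht
    have h0 : T 0 ≤ t := (hmono.monotone k.zero_le).trans ht.1
    have hs := (exists_mem_Ico_of_tendsto_atTop hT' h0).choose_spec.2
    have e : idx t = (exists_mem_Ico_of_tendsto_atTop hT' h0).choose := dif_pos h0
    rw [← e] at hs
    have h1 := hmono.lt_iff_lt.1 (hs.1.trans_lt ht.2)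
    have h2 := hmono.lt_iff_lt.1 (ht.1.trans_lt hs.2)
    omega
  let x : ℝ → X := fun t => φ (idx t) (y (idx t)) t
  have hx : ∀ k, ∀ t ∈ Icc (T k) (T (k + 1)), x t = φ k (y k) t := by
    intro k t ht
    rcases ht.2.eq_or_lt with rfl | h
    · simp only [x]
      rw [hidx (k + 1) _ ⟨le_rfl, hT _⟩, hφ0, hy]
    · simp only [x]
      rw [hidx k t ⟨ht.1, h⟩]
  refine ⟨x, ?_, fun k t ht => ?_⟩
  · exact (hx 0 _ ⟨le_rfl, (hT 0).le⟩).trans (hφ0 _ _)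
  · rw [hx k t ht]
    exact (hφ k (y k) t ht).congr (hx k) (hx k t ht)

end Ode

/-! ### The closed loop as an autonomous equation -/

section Lipschitz

variable {Z X Y : Type*} [NormedAddCommGroup Z] [NormedAddCommGroup X] [NormedAddCommGroup Y]

theorem LocallyLipschitz.clm_apply [NormedSpace ℝ X] [NormedSpace ℝ Y]
    {A : Z → X →L[ℝ] Y} {f : Z → X} (hA : LocallyLipschitz A)
    (hf : LocallyLipschitz f) : LocallyLipschitz fun z => A z (f z) :=
  (isBoundedBilinearMap_apply.contDiff (𝕜 := ℝ) (E := X →L[ℝ] Y) (F := X)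
    (n := 1)).locallyLipschitz.comp (hA.prodMk hf)

theorem LocallyLipschitz.pi {ι : Type*} [Fintype ι] {f : Z → ι → X}
    (hf : ∀ i, LocallyLipschitz fun z => f z i) : LocallyLipschitz f := fun z => by
  choose K t ht hK using fun i => hf i z
  refine ⟨∑ i, K i, ⋂ i, t i, iInter_mem.2 ht, fun x hx y hy => ?_⟩
  refine edist_pi_le_iff.2 fun i => (hK i (mem_iInter.1 hx i) (mem_iInter.1 hy i)).trans ?_
  gcongr
  exact Finset.single_le_sum (f := K) (fun _ _ => zero_le) (Finset.mem_univ i)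

namespace ELSystem

variable {Z E Q : Type} [NormedAddCommGroup Z]
  [NormedAddCommGroup E] [InnerProductSpace ℝ E] [CompleteSpace E]
  [NormedAddCommGroup Q] [InnerProductSpace ℝ Q] [CompleteSpace Q] (s : ELSystem E Q)
  {f g h k : Z → E}

theorem locallyLipschitz_Y_comp (hf : LocallyLipschitz f) (hg : LocallyLipschitz g)
    (hh : LocallyLipschitz h) (hk : LocallyLipschitz k) :
    LocallyLipschitz fun z => s.Y (f z) (g z) (h z) (k z) :=
  have h1 : LocallyLipschitz fun z => (f z, g z, h z, k z) :=
    hf.prodMk (hg.prodMk (hh.prodMk hk))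
  have h2 := s.locallyLipschitz_Y.comp h1
  h2

theorem locallyLipschitz_Cor_comp (hf : LocallyLipschitz f) (hg : LocallyLipschitz g) :
    LocallyLipschitz fun z => s.Cor (f z) (g z) :=
  have h1 := s.locallyLipschitz_Cor.comp (hf.prodMk hg)
  h1

theorem contDiff_inverse_M [FiniteDimensional ℝ E] : ContDiff ℝ 1 fun q => (s.M q).inverse :=
  contDiff_iff_contDiffAt.2 fun q =>
    (s.isPosDef_M q).isInvertible.contDiffAt_map_inverse.comp q s.contDiff_M.contDiffAt

end ELSystem

end Lipschitz

/-- The states of the network with fixed leader matrix, as a normed space: positions, velocities,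
estimates, the followers' observers of the leader's matrix, the leader's state, and the followers'
observers of it. -/
abbrev NetVec (N : ℕ) (E F Q : Type) [NormedAddCommGroup E] [InnerProductSpace ℝ E]
    [NormedAddCommGroup F] [InnerProductSpace ℝ F]
    [NormedAddCommGroup Q] [InnerProductSpace ℝ Q] : Type :=
  (Fin N → E) × (Fin N → E) × (Fin N → Q) × (Fin N → (F →L[ℝ] F)) × F × (Fin N → F)

section NetVec

variable {N : ℕ} {E F Q : Type} [NormedAddCommGroup E] [InnerProductSpace ℝ E]
  [NormedAddCommGroup F] [InnerProductSpace ℝ F] [NormedAddCommGroup Q] [InnerProductSpace ℝ Q]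

namespace NetVec

/-- The state of the network with leader matrix `S` that is described by `z`. -/
def toState (S : F →L[ℝ] F) (z : NetVec N E F Q) : NetState N E F Q where
  q := z.1
  w := z.2.1
  Θ := z.2.2.1
  S := Fin.cons S z.2.2.2.1
  η := Fin.cons z.2.2.2.2.1 z.2.2.2.2.2

variable {S : F →L[ℝ] F}

theorem contDiff_q (i : Fin N) :
    ContDiff ℝ 1 fun z : NetVec N E F Q => (toState S z).q i := by
  simp only [toState]; fun_prop

theorem contDiff_w (i : Fin N) :
    ContDiff ℝ 1 fun z : NetVec N E F Q => (toState S z).w i := by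
  simp only [toState]; fun_prop

theorem contDiff_Θ (i : Fin N) :
    ContDiff ℝ 1 fun z : NetVec N E F Q => (toState S z).Θ i := by
  simp only [toState]; fun_prop

theorem contDiff_S (i : Fin (N + 1)) :
    ContDiff ℝ 1 fun z : NetVec N E F Q => (toState S z).S i := by
  cases i using Fin.cases with
  | zero => exact contDiff_const
  | succ i => simp only [toState, Fin.cons_succ]; fun_prop

theorem contDiff_η (i : Fin (N + 1)) :
    ContDiff ℝ 1 fun z : NetVec N E F Q => (toState S z).η i := by
  cases i using Fin.cases with
  | zero => simp only [toState, Fin.cons_zero]; fun_prop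
  | succ i => simp only [toState, Fin.cons_succ]; fun_prop

variable {law : AdaptiveLaw N E F Q} {A : Matrix (Fin (N + 1)) (Fin (N + 1)) ℝ}

theorem contDiff_SDot (i : Fin N) :
    ContDiff ℝ 1 fun z : NetVec N E F Q => law.SDot A (toState S z) i :=
  (ContDiff.sum fun j _ => ((contDiff_S j).sub (contDiff_S i.succ)).const_smul _).const_smul _

theorem contDiff_ηDot (i : Fin N) :
    ContDiff ℝ 1 fun z : NetVec N E F Q => law.ηDot A (toState S z) i :=
  ((contDiff_S i.succ).clm_apply (contDiff_η i.succ)).add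
    ((ContDiff.sum fun j _ => ((contDiff_η j).sub (contDiff_η i.succ)).const_smul _).const_smul _)

theorem contDiff_refVel (i : Fin N) :
    ContDiff ℝ 1 fun z : NetVec N E F Q => law.refVel (toState S z) i :=
  (law.C.contDiff.comp ((contDiff_S i.succ).clm_apply (contDiff_η i.succ))).sub
    (((contDiff_q i).sub (law.C.contDiff.comp (contDiff_η i.succ))).const_smul _)

theorem contDiff_refAcc (i : Fin N) :
    ContDiff ℝ 1 fun z : NetVec N E F Q => law.refAcc A (toState S z) i :=
  (law.C.contDiff.comp (((contDiff_SDot i).clm_apply (contDiff_η i.succ)).add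
    ((contDiff_S i.succ).clm_apply (contDiff_ηDot i)))).sub
    (((contDiff_w i).sub (law.C.contDiff.comp (contDiff_ηDot i))).const_smul _)

theorem contDiff_s (i : Fin N) :
    ContDiff ℝ 1 fun z : NetVec N E F Q => law.s (toState S z) i :=
  (contDiff_w i).sub (contDiff_refVel i)

end NetVec

end NetVec

section Field

variable {N : ℕ}
  {E : Type} [NormedAddCommGroup E] [InnerProductSpace ℝ E] [CompleteSpace E]
  {F : Type} [NormedAddCommGroup F] [InnerProductSpace ℝ F] [CompleteSpace F]
  {Q : Type} [NormedAddCommGroup Q] [InnerProductSpace ℝ Q] [CompleteSpace Q]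

/-- The acceleration of follower `i` under the control law. -/
noncomputable def acceleration (sys : Fin N → ELSystem E Q) (law : AdaptiveLaw N E F Q)
    (A : Matrix (Fin (N + 1)) (Fin (N + 1)) ℝ) (x : NetState N E F Q) (i : Fin N) : E :=
  ((sys i).M (x.q i)).inverse
    (law.torque A x i - (sys i).Cor (x.q i) (x.w i) (x.w i) - (sys i).G (x.q i))

/-- The vector field of the closed loop for constant weights `A`. -/
noncomputable def loopField (sys : Fin N → ELSystem E Q) (S : F →L[ℝ] F)
    (law : AdaptiveLaw N E F Q) (A : Matrix (Fin (N + 1)) (Fin (N + 1)) ℝ) (z : NetVec N E F Q) :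
    NetVec N E F Q :=
  (z.2.1, fun i => acceleration sys law A (NetVec.toState S z) i,
    fun i => law.ΘDot A (NetVec.toState S z) i, fun i => law.SDot A (NetVec.toState S z) i,
    S z.2.2.2.2.1, fun i => law.ηDot A (NetVec.toState S z) i)

variable {sys : Fin N → ELSystem E Q} {S : F →L[ℝ] F} {law : AdaptiveLaw N E F Q}
  {A : Matrix (Fin (N + 1)) (Fin (N + 1)) ℝ}

namespace NetVec

theorem locallyLipschitz_regr (hY : ∀ i, law.Y i = (sys i).Y) (i : Fin N) :
    LocallyLipschitz fun z : NetVec N E F Q => law.regr A (toState S z) i := by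
  simp only [AdaptiveLaw.regr, hY]
  exact (sys i).locallyLipschitz_Y_comp (contDiff_q i).locallyLipschitz
    (contDiff_w i).locallyLipschitz (contDiff_refAcc i).locallyLipschitz
    (contDiff_refVel i).locallyLipschitz

theorem locallyLipschitz_torque (hY : ∀ i, law.Y i = (sys i).Y) (i : Fin N) :
    LocallyLipschitz fun z : NetVec N E F Q => law.torque A (toState S z) i :=
  ((law.K i).contDiff.comp (contDiff_s i)).neg.locallyLipschitz.add
    ((locallyLipschitz_regr hY i).clm_apply (contDiff_Θ i).locallyLipschitz)

theorem locallyLipschitz_ΘDot (hY : ∀ i, law.Y i = (sys i).Y) (i : Fin N) :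
    LocallyLipschitz fun z : NetVec N E F Q => law.ΘDot A (toState S z) i := by
  have h1 : LocallyLipschitz fun z : NetVec N E F Q =>
      ContinuousLinearMap.adjoint (law.regr A (toState S z) i) :=
    (ContinuousLinearMap.adjoint (𝕜 := ℝ) (E := Q) (F := E)).lipschitz.locallyLipschitz.comp
      (locallyLipschitz_regr hY i)
  exact ((-(law.Λ i).inverse).contDiff (n := 1)).locallyLipschitz.comp
    (h1.clm_apply (contDiff_s i).locallyLipschitz)

theorem locallyLipschitz_acceleration [FiniteDimensional ℝ E] (hY : ∀ i, law.Y i = (sys i).Y)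
    (i : Fin N) :
    LocallyLipschitz fun z : NetVec N E F Q => acceleration sys law A (toState S z) i := by
  have hM : LocallyLipschitz fun z : NetVec N E F Q => ((sys i).M ((toState S z).q i)).inverse :=
    ((sys i).contDiff_inverse_M.comp (contDiff_q i)).locallyLipschitz
  have hG : LocallyLipschitz fun z : NetVec N E F Q => (sys i).G ((toState S z).q i) :=
    (sys i).locallyLipschitz_G.comp (contDiff_q i).locallyLipschitz
  have hCor : LocallyLipschitz fun z : NetVec N E F Q =>
      (sys i).Cor ((toState S z).q i) ((toState S z).w i) ((toState S z).w i) :=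
    ((sys i).locallyLipschitz_Cor_comp (contDiff_q i).locallyLipschitz
      (contDiff_w i).locallyLipschitz).clm_apply (contDiff_w i).locallyLipschitz
  exact hM.clm_apply (((locallyLipschitz_torque hY i).sub hCor).sub hG)

end NetVec

theorem locallyLipschitz_loopField [FiniteDimensional ℝ E] (hY : ∀ i, law.Y i = (sys i).Y) :
    LocallyLipschitz (loopField sys S law A) := by
  refine LocallyLipschitz.prodMk ?_ (LocallyLipschitz.prodMk ?_ (LocallyLipschitz.prodMk ?_
    (LocallyLipschitz.prodMk ?_ (LocallyLipschitz.prodMk ?_ ?_))))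
  · exact (ContDiff.locallyLipschitz (𝕂 := ℝ) (by fun_prop))
  · exact .pi fun i => NetVec.locallyLipschitz_acceleration hY i
  · exact .pi fun i => NetVec.locallyLipschitz_ΘDot hY i
  · exact .pi fun i => (NetVec.contDiff_SDot i).locallyLipschitz
  · exact (ContDiff.locallyLipschitz (𝕂 := ℝ) (by fun_prop))
  · exact .pi fun i => (NetVec.contDiff_ηDot i).locallyLipschitz

theorem acceleration_spec [FiniteDimensional ℝ E] (x : NetState N E F Q) (i : Fin N) :
    (sys i).M (x.q i) (acceleration sys law A x i) + (sys i).Cor (x.q i) (x.w i) (x.w i) +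
      (sys i).G (x.q i) = law.torque A x i := by
  rw [acceleration, ((sys i).isPosDef_M (x.q i)).apply_inverse]
  abel

theorem isLoopOn_of_solution [FiniteDimensional ℝ E] {z : ℝ → NetVec N E F Q} {a b : ℝ}
    (hz : ∀ t ∈ Icc a b, HasDerivWithinAt z (loopField sys S law A (z t)) (Icc a b) t) :
    IsLoopOn sys S law (fun _ => A) (fun t => NetVec.toState S (z t)) a b where
  leader_S _ _ := rfl
  leader_v := .of_hasDerivWithinAt fun _ ht => (hz _ ht).snd.snd.snd.snd.fst
  position i := (RightDerivOn.of_hasDerivWithinAt fun _ ht => (hz _ ht).fst).apply i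
  velocity i := ⟨_, (RightDerivOn.of_hasDerivWithinAt fun _ ht => (hz _ ht).snd.fst).apply i,
    fun _ _ => acceleration_spec _ i⟩
  estimate i := (RightDerivOn.of_hasDerivWithinAt fun _ ht => (hz _ ht).snd.snd.fst).apply i
  observer_S i :=
    (RightDerivOn.of_hasDerivWithinAt fun _ ht => (hz _ ht).snd.snd.snd.fst).apply i
  observer_η i :=
    (RightDerivOn.of_hasDerivWithinAt fun _ ht => (hz _ ht).snd.snd.snd.snd.snd).apply i

end Field

/-! ### Global existence, distributedness and consensus -/

theorem norm_sum_smul_sub_le {V X : Type*} [Fintype V] [NormedAddCommGroup X] [NormedSpace ℝ X]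
    (a : V → V → ℝ) (x : V → X) (i : V) :
    ‖∑ j, a i j • (x j - x i)‖ ≤ (∑ i, ∑ j, |a i j|) * 2 * ‖x‖ := by
  have h1 : ∀ j, ‖a i j • (x j - x i)‖ ≤ |a i j| * (2 * ‖x‖) := fun j => by
    rw [norm_smul, Real.norm_eq_abs]
    gcongr
    linarith [norm_sub_le (x j) (x i), norm_le_pi_norm x i, norm_le_pi_norm x j]
  have h2 : ∑ j, |a i j| ≤ ∑ i, ∑ j, |a i j| :=
    Finset.single_le_sum (f := fun i => ∑ j, |a i j|)
      (fun i _ => Finset.sum_nonneg fun j _ => abs_nonneg _) (Finset.mem_univ i)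
  calc ‖∑ j, a i j • (x j - x i)‖ ≤ ∑ j, |a i j| * (2 * ‖x‖) :=
        (norm_sum_le _ _).trans (Finset.sum_le_sum fun j _ => h1 j)
    _ = (∑ j, |a i j|) * (2 * ‖x‖) := by rw [Finset.sum_mul]
    _ ≤ (∑ i, ∑ j, |a i j|) * (2 * ‖x‖) := by gcongr
    _ = _ := by ring

section Existence

variable {N n₀ : ℕ}
  {E : Type} [NormedAddCommGroup E] [InnerProductSpace ℝ E] [CompleteSpace E]
  {F : Type} [NormedAddCommGroup F] [InnerProductSpace ℝ F] [CompleteSpace F]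
  {Q : Type} [NormedAddCommGroup Q] [InnerProductSpace ℝ Q] [CompleteSpace Q]
  {sys : Fin N → ELSystem E Q} {S : F →L[ℝ] F} {law : AdaptiveLaw N E F Q}
  {A : Matrix (Fin (N + 1)) (Fin (N + 1)) ℝ}

namespace IsLoopOn

theorem exists_bound_S (sys : Fin N → ELSystem E Q) (S : F →L[ℝ] F) (law : AdaptiveLaw N E F Q)
    (A : Matrix (Fin (N + 1)) (Fin (N + 1)) ℝ) (a b : ℝ) (x₀ : NetState N E F Q) :
    ∃ R, 0 ≤ R ∧ ∀ c ∈ Icc a b, ∀ x, IsLoopOn sys S law (fun _ => A) x a c → x a = x₀ →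
      ∀ t ∈ Icc a c, ∀ j, ‖(x t).S j‖ ≤ R := by
  set k := (∑ i, ∑ j, |followerWeights A law.μ₁ i j|) * 2
  have hk : 0 ≤ k := by positivity
  refine ⟨Real.exp (k * (b - a)) * ‖x₀.S‖, by positivity, fun c hc x hx hxa t ht j => ?_⟩
  have h1 := (RightDerivOn.pi hx.observer_S').norm_le_of_linear_growth hk le_rfl (fun t ht => by
    rw [add_zero]
    exact (pi_norm_le_iff_of_nonneg (by positivity)).2 fun i => norm_sum_smul_sub_le _ _ i) ht
  rw [zero_mul, add_zero] at h1
  refine (norm_le_pi_norm (fun i => (x t).S i) j).trans (h1.trans ?_)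
  rw [hxa]
  have : t - a ≤ b - a := by linarith [ht.2, hc.2]
  gcongr

theorem exists_bound_η (sys : Fin N → ELSystem E Q) (S : F →L[ℝ] F) (law : AdaptiveLaw N E F Q)
    (A : Matrix (Fin (N + 1)) (Fin (N + 1)) ℝ) (a b : ℝ) (x₀ : NetState N E F Q) :
    ∃ R, 0 ≤ R ∧ ∀ c ∈ Icc a b, ∀ x, IsLoopOn sys S law (fun _ => A) x a c → x a = x₀ →
      ∀ t ∈ Icc a c, ∀ j, ‖(x t).η j‖ ≤ R := by
  obtain ⟨R, hR0, hR⟩ := exists_bound_S sys S law A a b x₀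
  set k := (∑ i, ∑ j, |followerWeights A law.μ₂ i j|) * 2
  have hk : 0 ≤ k := by positivity
  refine ⟨Real.exp ((R + k) * (b - a)) * ‖x₀.η‖, by positivity, fun c hc x hx hxa t ht j => ?_⟩
  have h1 := (RightDerivOn.pi hx.observer_η').norm_le_of_linear_growth (k := R + k)
    (by positivity) le_rfl (fun t ht => by
      rw [add_zero]
      refine (pi_norm_le_iff_of_nonneg (by positivity)).2 fun i => (norm_add_le _ _).trans ?_
      rw [add_mul]
      refine add_le_add (((x t).S i).le_of_opNorm_le_of_le
        (hR c hc x hx hxa t (Ico_subset_Icc_self ht) i) (norm_le_pi_norm (fun i => (x t).η i) i))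
        (norm_sum_smul_sub_le _ _ i)) ht
  rw [zero_mul, add_zero] at h1
  refine (norm_le_pi_norm (fun i => (x t).η i) j).trans (h1.trans ?_)
  rw [hxa]
  have : t - a ≤ b - a := by linarith [ht.2, hc.2]
  gcongr

/-- A priori bounds for one follower on a bounded interval: the observers obey linear equations,
the Lyapunov function bounds the velocity error and the estimate, and with these the position
grows at most exponentially. -/
theorem exists_bound_follower [FiniteDimensional ℝ E] [FiniteDimensional ℝ Q]
    (hY : ∀ i, law.Y i = (sys i).Y) {i : Fin N} (hΛ : IsPosDef (law.Λ i)) (hK : IsPosDef (law.K i))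
    {km : ℝ} (hkm : 0 < km) (hM : ∀ q y, km * ‖y‖ ^ 2 ≤ inner ℝ y ((sys i).M q y))
    (a b : ℝ) (x₀ : NetState N E F Q) :
    ∃ R, ∀ c ∈ Icc a b, ∀ x, IsLoopOn sys S law (fun _ => A) x a c → x a = x₀ →
      ‖(x c).q i‖ ≤ R ∧ ‖(x c).w i‖ ≤ R ∧ ‖(x c).Θ i‖ ≤ R := by
  obtain ⟨RS, hRS0, hRS⟩ := exists_bound_S sys S law A a b x₀
  obtain ⟨Rη, hRη0, hRη⟩ := exists_bound_η sys S law A a b x₀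
  obtain ⟨kl, hkl, hl⟩ := hΛ.exists_coercive
  obtain ⟨kK, hkK, hK⟩ := hK.exists_coercive
  set Bs := √(2 * lyapunov sys law x₀ i / km)
  set BΘ := √(2 * lyapunov sys law x₀ i / kl)
  set c₀ := Bs + ‖law.C‖ * (RS * Rη) + |law.α| * (‖law.C‖ * Rη) with hc₀
  have hc₀' : 0 ≤ c₀ := by positivity
  by_cases hab : a ≤ b
  swap
  · exact ⟨0, fun c hc => absurd (hc.1.trans hc.2) hab⟩
  have hba : 0 ≤ b - a := sub_nonneg.2 hab
  set Rq := Real.exp (|law.α| * (b - a)) * (‖x₀.q i‖ + c₀ * (b - a)) with hRq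
  have hRq0 : 0 ≤ Rq := by positivity
  refine ⟨max Rq (max (|law.α| * Rq + c₀) (BΘ + ‖(sys i).Θ‖)), fun c hc x hx hxa => ?_⟩
  have herr : ∀ t ∈ Icc a c, ‖law.s (x t) i‖ ≤ Bs ∧ ‖(x t).Θ i - (sys i).Θ‖ ≤ BΘ := fun t ht => by
    have := hx.norm_error_le hY hΛ.1 hΛ.apply_inverse
      (fun y => (by positivity : 0 ≤ kK * ‖y‖ ^ 2).trans (hK y)) hkm hkl hM hl ht
    rwa [hxa] at this
  have hw : ∀ t ∈ Icc a c, ‖(x t).w i‖ ≤ |law.α| * ‖(x t).q i‖ + c₀ := fun t ht => by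
    have e : (x t).w i = law.s (x t) i + (law.C ((x t).S i.succ ((x t).η i.succ)) -
        law.α • ((x t).q i - law.C ((x t).η i.succ))) := by
      simp only [AdaptiveLaw.s, AdaptiveLaw.refVel, sub_add_cancel]
    have hη := hRη c hc x hx hxa t ht i.succ
    have h1 : ‖law.C ((x t).S i.succ ((x t).η i.succ))‖ ≤ ‖law.C‖ * (RS * Rη) :=
      law.C.le_of_opNorm_le_of_le le_rfl
        (((x t).S i.succ).le_of_opNorm_le_of_le (hRS c hc x hx hxa t ht i.succ) hη)
    have h2 : ‖law.C ((x t).η i.succ)‖ ≤ ‖law.C‖ * Rη := law.C.le_of_opNorm_le_of_le le_rfl hη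
    have h3 : ‖law.α • ((x t).q i - law.C ((x t).η i.succ))‖ ≤
        |law.α| * (‖(x t).q i‖ + ‖law.C‖ * Rη) := by
      rw [norm_smul, Real.norm_eq_abs]
      gcongr
      exact (norm_sub_le _ _).trans (by gcongr)
    rw [e]
    refine (norm_add_le _ _).trans ((add_le_add_right (norm_sub_le _ _) _).trans ?_)
    linarith [(herr t ht).1]
  have hcc : c ∈ Icc a c := ⟨hc.1, le_rfl⟩
  have hq : ‖(x c).q i‖ ≤ Rq := by
    have h1 := (hx.position i).norm_le_of_linear_growth (abs_nonneg law.α) hc₀'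
      (fun t ht => hw t (Ico_subset_Icc_self ht)) hcc
    rw [hxa] at h1
    refine h1.trans ?_
    have h2 : c - a ≤ b - a := by linarith [hc.2]
    have h3 : 0 ≤ c - a := sub_nonneg.2 hc.1
    rw [hRq]
    gcongr
  refine ⟨hq.trans (le_max_left _ _), (hw c hcc).trans ((?_ : _ ≤ |law.α| * Rq + c₀).trans
    ((le_max_left _ _).trans (le_max_right _ _))), ?_⟩
  · gcongr
  · have h1 := (herr c hcc).2
    refine (?_ : _ ≤ BΘ + ‖(sys i).Θ‖).trans ((le_max_right _ _).trans (le_max_right _ _))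
    linarith [norm_le_norm_add_norm_sub' ((x c).Θ i) (sys i).Θ]

end IsLoopOn

/-- A priori bound for the closed loop with constant weights on a bounded interval. -/
theorem exists_loopField_bound [FiniteDimensional ℝ E] [FiniteDimensional ℝ Q]
    (hY : ∀ i, law.Y i = (sys i).Y) (hΛ : ∀ i, IsPosDef (law.Λ i)) (hK : ∀ i, IsPosDef (law.K i))
    {km : ℝ} (hkm : 0 < km) (hM : ∀ i q y, km * ‖y‖ ^ 2 ≤ inner ℝ y ((sys i).M q y))
    (a b : ℝ) (z₀ : NetVec N E F Q) :
    ∃ R, ∀ c ∈ Icc a b, ∀ z : ℝ → NetVec N E F Q, z a = z₀ →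
      (∀ t ∈ Icc a c, HasDerivWithinAt z (loopField sys S law A (z t)) (Icc a c) t) →
      ‖z c‖ ≤ R := by
  obtain ⟨RS, hRS0, hRS⟩ := IsLoopOn.exists_bound_S sys S law A a b (NetVec.toState S z₀)
  obtain ⟨Rη, hRη0, hRη⟩ := IsLoopOn.exists_bound_η sys S law A a b (NetVec.toState S z₀)
  choose R hR using fun i => IsLoopOn.exists_bound_follower (S := S) (A := A) hY (hΛ i) (hK i) hkm
    (hM i) a b (NetVec.toState S z₀)
  obtain ⟨R', hR'⟩ := Finite.exists_le R
  refine ⟨max (max R' 0) (max RS Rη), fun c hc z hz0 hz => ?_⟩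
  have hx := isLoopOn_of_solution hz
  have hxa : NetVec.toState S (z a) = NetVec.toState S z₀ := by rw [hz0]
  have hcc : c ∈ Icc a c := ⟨hc.1, le_rfl⟩
  have hpos : 0 ≤ max (max R' 0) (max RS Rη) := hRS0.trans ((le_max_left _ _).trans
    (le_max_right _ _))
  have hle : ∀ i, R i ≤ max (max R' 0) (max RS Rη) := fun i =>
    (hR' i).trans ((le_max_left _ _).trans (le_max_left _ _))
  have hη : ∀ j, ‖(NetVec.toState S (z c)).η j‖ ≤ max (max R' 0) (max RS Rη) := fun j =>
    (hRη c hc _ hx hxa c hcc j).trans ((le_max_right _ _).trans (le_max_right _ _))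
  have hS : ∀ j, ‖(NetVec.toState S (z c)).S j‖ ≤ max (max R' 0) (max RS Rη) := fun j =>
    (hRS c hc _ hx hxa c hcc j).trans ((le_max_left _ _).trans (le_max_right _ _))
  have hf := fun i => hR i c hc _ hx hxa
  simp only [norm_prod_le_iff, pi_norm_le_iff_of_nonneg hpos]
  exact ⟨fun i => (hf i).1.trans (hle i), fun i => (hf i).2.1.trans (hle i),
    fun i => (hf i).2.2.trans (hle i), fun i => hS i.succ, hη 0, fun i => hη i.succ⟩

/-- Near any time the half line consists of at most two of the closed intervals between switching
instants. -/
theorem SwitchingSignal.exists_union_mem_nhdsWithin {P : Type} (σ : SwitchingSignal P) {t : ℝ}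
    (ht : 0 ≤ t) : ∃ k l, t ∈ Icc (σ.t k) (σ.t (k + 1)) ∧ t ∈ Icc (σ.t l) (σ.t (l + 1)) ∧
      Icc (σ.t k) (σ.t (k + 1)) ∪ Icc (σ.t l) (σ.t (l + 1)) ∈ 𝓝[Ici 0] t := by
  obtain ⟨k, hk⟩ := σ.exists_mem_Ico ht
  rcases k with _ | k
  · refine ⟨0, 0, Ico_subset_Icc_self hk, Ico_subset_Icc_self hk, ?_⟩
    refine mem_of_superset (inter_mem_nhdsWithin (Ici 0) (Iio_mem_nhds hk.2)) fun u hu => ?_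
    exact Or.inl ⟨σ.t_zero.le.trans hu.1, le_of_lt hu.2⟩
  · by_cases h : t = σ.t (k + 1)
    · refine ⟨k, k + 1, ⟨h ▸ (σ.t_lt_succ k).le, h.le⟩, Ico_subset_Icc_self hk,
        mem_nhdsWithin_of_mem_nhds ?_⟩
      rw [Icc_union_Icc_eq_Icc (σ.t_lt_succ k).le (σ.t_lt_succ (k + 1)).le]
      exact Icc_mem_nhds (h ▸ σ.t_lt_succ k) hk.2
    · refine ⟨k + 1, k + 1, Ico_subset_Icc_self hk, Ico_subset_Icc_self hk,
        mem_nhdsWithin_of_mem_nhds ?_⟩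
      rw [union_self]
      exact Icc_mem_nhds (lt_of_le_of_ne hk.1 (Ne.symm h)) hk.2

theorem SwitchingSignal.hasDerivWithinAt_Ici {P X : Type} [NormedAddCommGroup X] [NormedSpace ℝ X]
    (σ : SwitchingSignal P) {f f' : ℝ → X}
    (h : ∀ k, ∀ t ∈ Icc (σ.t k) (σ.t (k + 1)),
      HasDerivWithinAt f (f' t) (Icc (σ.t k) (σ.t (k + 1))) t) {t : ℝ} (ht : 0 ≤ t) :
    HasDerivWithinAt f (f' t) (Ici 0) t := by
  obtain ⟨k, l, hk, hl, hkl⟩ := σ.exists_union_mem_nhdsWithin ht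
  exact ((h k t hk).union (h l t hl)).mono_of_mem_nhdsWithin hkl

theorem SwitchingSignal.piecewiseDeriv {P X : Type} [NormedAddCommGroup X] [NormedSpace ℝ X]
    (σ : SwitchingSignal P) {f : ℝ → X} {g : P → ℝ → X}
    (h : ∀ k, ∀ t ∈ Icc (σ.t k) (σ.t (k + 1)),
      HasDerivWithinAt f (g (σ.σ (σ.t k)) t) (Icc (σ.t k) (σ.t (k + 1))) t) :
    PiecewiseDeriv σ f fun t => g (σ.σ t) t := by
  refine ⟨fun t ht => ?_, fun k t ht => ?_⟩
  · obtain ⟨k, l, hk, hl, hkl⟩ := σ.exists_union_mem_nhdsWithin ht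
    exact ((h k t hk).continuousWithinAt.union
      (h l t hl).continuousWithinAt).mono_of_mem_nhdsWithin hkl
  · dsimp only
    rw [σ.const k t ht]
    exact (h k t (Ico_subset_Icc_self ht)).mono Ico_subset_Icc_self

/-- Global existence for the closed loop. -/
theorem exists_isClosedLoop [FiniteDimensional ℝ E] [FiniteDimensional ℝ F] [FiniteDimensional ℝ Q]
    (hY : ∀ i, law.Y i = (sys i).Y) (hΛ : ∀ i, IsPosDef (law.Λ i)) (hK : ∀ i, IsPosDef (law.K i))
    {km : ℝ} (hkm : 0 < km) (hM : ∀ i q y, km * ‖y‖ ^ 2 ≤ inner ℝ y ((sys i).M q y))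
    (σ : SwitchingSignal (Fin n₀)) (A : Fin n₀ → Matrix (Fin (N + 1)) (Fin (N + 1)) ℝ)
    (x₀ : NetState N E F Q) (hx₀ : x₀.S 0 = S) :
    ∃ x : ℝ → NetState N E F Q, IsClosedLoop sys S law σ A x ∧ x 0 = x₀ := by
  obtain ⟨z, hz0, hz⟩ := exists_glued_solution (T := σ.t) σ.t_lt_succ σ.t_tendsto
    (f := fun k => loopField sys S law (A (σ.σ (σ.t k))))
    (fun k z₀ => by
      obtain ⟨R, hR⟩ := exists_loopField_bound (S := S) (A := A (σ.σ (σ.t k))) hY hΛ hK hkm hM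
        (σ.t k) (σ.t (k + 1)) z₀
      exact exists_solution_of_apriori_bound (locallyLipschitz_loopField hY) (σ.t_lt_succ k).le z₀
        hR)
    (x₀.q, x₀.w, x₀.Θ, fun i => x₀.S i.succ, x₀.η 0, fun i => x₀.η i.succ)
  refine ⟨fun t => NetVec.toState S (z t), ⟨fun _ _ => rfl, fun t ht => ?_, fun i t ht => ?_,
    fun i => ⟨fun t => acceleration sys law (A (σ.σ t)) (NetVec.toState S (z t)) i, ?_,
      fun t _ => acceleration_spec _ i⟩, fun i => ?_, fun i => ?_, fun i => ?_⟩, ?_⟩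
  · exact σ.hasDerivWithinAt_Ici (f := fun t => (z t).2.2.2.2.1)
      (f' := fun t => S (z t).2.2.2.2.1) (fun k t ht => (hz k t ht).snd.snd.snd.snd.fst) ht
  · exact σ.hasDerivWithinAt_Ici (f := fun t => (z t).1 i) (f' := fun t => (z t).2.1 i)
      (fun k t ht => hasDerivWithinAt_pi.1 (hz k t ht).fst i) ht
  · exact σ.piecewiseDeriv
      (g := fun P t => acceleration sys law (A P) (NetVec.toState S (z t)) i)
      fun k t ht => hasDerivWithinAt_pi.1 (hz k t ht).snd.fst i
  · exact σ.piecewiseDeriv (g := fun P t => law.ΘDot (A P) (NetVec.toState S (z t)) i)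
      fun k t ht => hasDerivWithinAt_pi.1 (hz k t ht).snd.snd.fst i
  · exact σ.piecewiseDeriv (g := fun P t => law.SDot (A P) (NetVec.toState S (z t)) i)
      fun k t ht => hasDerivWithinAt_pi.1 (hz k t ht).snd.snd.snd.fst i
  · exact σ.piecewiseDeriv (g := fun P t => law.ηDot (A P) (NetVec.toState S (z t)) i)
      fun k t ht => hasDerivWithinAt_pi.1 (hz k t ht).snd.snd.snd.snd.snd i
  · rw [σ.t_zero] at hz0
    have hS : (Fin.cons S fun i : Fin N => x₀.S i.succ : Fin (N + 1) → F →L[ℝ] F) = x₀.S := by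
      rw [← hx₀]; exact Fin.cons_self_tail x₀.S
    have hη : (Fin.cons (x₀.η 0) fun i : Fin N => x₀.η i.succ : Fin (N + 1) → F) = x₀.η :=
      Fin.cons_self_tail x₀.η
    simp only [hz0, NetVec.toState, hS, hη]

end Existence

theorem AdaptiveLaw.isDistributed {N : ℕ}
    {E : Type} [NormedAddCommGroup E] [InnerProductSpace ℝ E] [CompleteSpace E]
    {F : Type} [NormedAddCommGroup F] [InnerProductSpace ℝ F] [CompleteSpace F]
    {Q : Type} [NormedAddCommGroup Q] [InnerProductSpace ℝ Q] [CompleteSpace Q]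
    (law : AdaptiveLaw N E F Q) {A : Matrix (Fin (N + 1)) (Fin (N + 1)) ℝ}
    {Γ : Digraph (Fin (N + 1))} (hA : IsWeightedAdjacency A Γ) : law.IsDistributed A Γ := by
  rintro i x x' ⟨hq, hw, hΘ, hS, hη, hnb⟩
  have hzero : ∀ j, ¬Γ.Adj j i.succ → A i.succ j = 0 := fun j hj =>
    le_antisymm (not_lt.1 fun h => hj ((hA.2.2 _ _).1 h)) (hA.1 _ _)
  have hSDot : law.SDot A x i = law.SDot A x' i := by
    unfold AdaptiveLaw.SDot
    congr 1
    refine Finset.sum_congr rfl fun j _ => ?_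
    by_cases hj : Γ.Adj j i.succ
    · rw [(hnb j hj).1]
    · rw [hzero j hj, zero_smul, zero_smul]
  have hηDot : law.ηDot A x i = law.ηDot A x' i := by
    unfold AdaptiveLaw.ηDot
    rw [hS, hη]
    congr 2
    refine Finset.sum_congr rfl fun j _ => ?_
    by_cases hj : Γ.Adj j i.succ
    · have := (hnb j hj).2
      rw [hη] at this
      rw [this]
    · rw [hzero j hj, zero_smul, zero_smul]
  have hrefVel : law.refVel x i = law.refVel x' i := by
    unfold AdaptiveLaw.refVel
    rw [hS, hη, hq]
  have hrefAcc : law.refAcc A x i = law.refAcc A x' i := by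
    unfold AdaptiveLaw.refAcc
    rw [hSDot, hηDot, hS, hη, hw]
  have hs : law.s x i = law.s x' i := by
    unfold AdaptiveLaw.s
    rw [hw, hrefVel]
  have hregr : law.regr A x i = law.regr A x' i := by
    unfold AdaptiveLaw.regr
    rw [hq, hw, hrefAcc, hrefVel]
  refine ⟨?_, ?_, hSDot, hηDot⟩
  · unfold AdaptiveLaw.torque
    rw [hs, hregr, hΘ]
  · unfold AdaptiveLaw.ΘDot
    rw [hs, hregr]

/-- Leader-following consensus of `N` Euler–Lagrange systems under a jointly connected directed
switching network. The law is distributed; from every initial condition `x₀` of the followers,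
the estimates, the observers and the leader (`x₀.η 0 = v(0)`; the leader's matrix is `S`) the
closed loop has a trajectory on `[0, ∞)`; and along every trajectory `qᵢ - q₀ → 0` and
`q̇ᵢ - q̇₀ → 0`, where `q₀ = C v` and so `q̇₀ = C S v`. -/
theorem theorem1 {N n m p n₀ : ℕ} (sys : Fin N → ELSystem (Vec n) (Vec p))
    (C : Vec m →L[ℝ] Vec n) (S : Vec m →L[ℝ] Vec m) (hobs : IsObservable C S)
    (σ : SwitchingSignal (Fin n₀)) (Γ : Fin n₀ → Digraph (Fin (N + 1)))
    (A : Fin n₀ → Matrix (Fin (N + 1)) (Fin (N + 1)) ℝ)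
    (hA : ∀ k, IsWeightedAdjacency (A k) (Γ k))
    (hleader : LeaderVelocityBounded C S)
    (hbounds : UniformlyBounded sys) (hreg : ∀ i, RegressorBounded (sys i))
    (hconn : JointlyConnected σ Γ)
    (μ₁ μ₂ α : ℝ) (hμ₁ : 0 < μ₁) (hμ₂ : 0 < μ₂) (hα : 0 < α)
    (K : Fin N → Vec n →L[ℝ] Vec n) (hK : ∀ i, IsPosDef (K i))
    (Λ : Fin N → Vec p →L[ℝ] Vec p) (hΛ : ∀ i, IsPosDef (Λ i))
    (law : AdaptiveLaw N (Vec n) (Vec m) (Vec p))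
    (hlaw : law = { Y := fun i => (sys i).Y, C := C, μ₁ := μ₁, μ₂ := μ₂, α := α, K := K, Λ := Λ }) :
    (∀ k, law.IsDistributed (A k) (Γ k)) ∧
    (∀ x₀ : NetState N (Vec n) (Vec m) (Vec p), x₀.S 0 = S →
      ∃ x : ℝ → NetState N (Vec n) (Vec m) (Vec p), IsClosedLoop sys S law σ A x ∧ x 0 = x₀) ∧
    ∀ x : ℝ → NetState N (Vec n) (Vec m) (Vec p), IsClosedLoop sys S law σ A x → ∀ i,
      Tendsto (fun t => (x t).q i - C ((x t).η 0)) atTop (𝓝 0) ∧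
      Tendsto (fun t => (x t).w i - C (S ((x t).η 0))) atTop (𝓝 0) := by
  obtain ⟨km, kM, kc, kg, hkm, -, -, -, hb⟩ := hbounds
  have hY : ∀ i, law.Y i = (sys i).Y := fun i => by rw [hlaw]
  have hΛ' : ∀ i, IsPosDef (law.Λ i) := fun i => by rw [hlaw]; exact hΛ i
  have hK' : ∀ i, IsPosDef (law.K i) := fun i => by rw [hlaw]; exact hK i
  have hC : law.C = C := by rw [hlaw]
  refine ⟨fun k => law.isDistributed (hA k), fun x₀ hx₀ => exists_isClosedLoop hY hΛ' hK' hkm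
    (fun i q y => ((hb i).1 q y).1) σ A x₀ hx₀, fun x hx i => ?_⟩
  have h := hx.isLoopOn
  obtain ⟨B, hB0, hB⟩ := hobs.exists_norm_mul_exp_le hleader
  have hexp := fun (t : ℝ) (ht : 0 ≤ t) => norm_exp_le_of_norm_mul_exp_le hB ht
  have hv : ∀ t : ℝ, 0 ≤ t → (x t).η 0 = NormedSpace.exp (t • S) ((x 0).η 0) :=
    fun t ht => hx.leader_v.eq_exp ht
  obtain ⟨T, ρ, ε, τ, w, hT⟩ := hconn.exists_jointlyRooted hA (μ := law.μ₁) (by rwa [hlaw])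
  obtain ⟨T', ρ', ε', τ', w', hT'⟩ := hconn.exists_jointlyRooted hA (μ := law.μ₂) (by rwa [hlaw])
  have hS := IsLoopOn.tendsto_observer_S h hT
  have hη := IsLoopOn.tendsto_observer_η h hT' hS hB0 hexp hv
  obtain ⟨kl, hkl, hl⟩ := (hΛ' i).exists_coercive
  obtain ⟨kK, hkK, hKc⟩ := (hK' i).exists_coercive
  obtain ⟨cA, hcA⟩ := Finite.exists_le fun z : Fin n₀ × Fin (N + 1) × Fin (N + 1) =>
    |A z.1 z.2.1 z.2.2|
  have := IsLoopOn.tendsto_of_observer h hS hη (c := (1 + B) * ‖(x 0).η 0‖)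
    (fun t ht => by
      rw [hv t ht]
      have h1 : 1 + B * t ≤ (1 + B) * (1 + t) := by nlinarith
      calc _ ≤ (1 + B * t) * ‖(x 0).η 0‖ :=
            ContinuousLinearMap.le_of_opNorm_le _ (hexp t ht) _
        _ ≤ ((1 + B) * (1 + t)) * ‖(x 0).η 0‖ := by gcongr
        _ = _ := by ring)
    ⟨B * ‖(x 0).η 0‖, eventually_atTop.2 ⟨0, fun t ht => by
      dsimp only
      rw [hv t ht]
      exact ContinuousLinearMap.le_of_opNorm_le _ (hB t ht) _⟩⟩
    (fun t j k => hcA (σ.σ t, j, k)) (by rwa [hlaw]) hY (hreg i) (hΛ' i).1 (hΛ' i).apply_inverse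
    hkl hl hkK hKc hkm (fun q y => ((hb i).1 q y).1) (hb i).2.1
  rwa [hC] at this
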